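/- Fix a free ultrafilter $\omega$ on $\mathbb{N}$. For a unital $C^*$-algebra $A$ let $A_\omega=\ell^\infty(\mathbb{N},A)/\{(a_n):\lim_\omega\|a_n\|=0\}$ be its ultrapower; regard $A\subset A_\omega$ as constant sequences, and let $A_\omega\cap A'$ be the relative commutant. For elements $a,b$ of a $C^*$-algebra with $b\ge 0$ write $a\lesssim b$ if there is a sequence $(x_n)$ with $\|x_nbx_n^*-a\|\to 0$ (then $a\ge 0$). An order zero map is a completely positive map $\phi$ (not assumed contractive) such that $\phi(a)\phi(b)=\phi(b)\phi(a)=0$ whenever $a,b\ge 0$ and $ab=ba=0$. A $*$-homomorphism $\theta:A\to B$ of unital $C^*$-algebras is called *tracially sequentially-split by order zero* if for every nonzero positive $z\in A_\omega$ there are an order zero map $\psi:B\to A_\omega$ and a nonzero positive $g\in A_\omega\cap A'$ such that $\psi(\theta(a))=ag$ for all $a\in A$ and $1-g\lesssim z$. If a topological group $G$ acts on $A$ and $B$ by point-norm continuous actions $\alpha,\beta$, an equivariant $*$-homomorphism $\theta:(A,\alpha)\to(B,\beta)$ is called *$G$-tracially sequentially-split by order zero* if for every nonzero positive $x\in A_\omega$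 there are an equivariant order zero map $\psi:(B,\beta)\to(A_\omega,\alpha_\omega)$ and a positive $g\in A_\omega\cap A'$ such that $\psi(\theta(a))=ga=ag$ for all $a\in A$ and $1-g\lesssim x$, where $\alpha_{\omega,s}([(a_n)])=[(\alpha_s(a_n))]$. Let $A$ and $C$ be unital $C^*$-algebras. (1) The first factor embedding $\mathrm{id}_A\otimes 1_C:A\to A\otimes_{\max}C$ is tracially sequentially-split by order zero if and only if for every nonzero positive $z\in A_\omega$ there is a nonzero order zero map $\phi:C\to A_\omega\cap A'$ such that $1-\phi(1_C)\lesssim z$ in $A_\omega$. (2) Let $\alpha:G\to\mathrm{Aut}(A)$ and $\beta:G\to\mathrm{Aut}(C)$ be point-norm continuous actions of a compact group $G$. The first factor embedding $\mathrm{id}_A\otimes 1_C:(A,\alpha)\to(A\otimes_{\max}C,\alpha\otimes\beta)$ is (equivariant and) $G$-tracially sequentially-split by order zero if and only if for every nonzero positive $x\in A_\omega$ there is an equivariant order zero map $\phi:(C,\beta)\to(A_\omega\cap A',\alpha_\omega)$ such that $1-\phi(1_C)\lesssim x$ in $A_\omega$. -/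

import Mathlib

open Filter Topology
open scoped BoundedContinuousFunction CStarAlgebra TensorProduct

noncomputable section

/-- The closed ideal `c_ω(ℕ, A)` of `ℓ^∞(ℕ, A)` of the bounded sequences with
`lim_ω ‖a_n‖ = 0`. As `ℕ` is discrete, `ℕ →ᵇ A` is `ℓ^∞(ℕ, A)`. -/
def ultraNull (ω : Ultrafilter ℕ) (A : Type*) [CStarAlgebra A] : Ideal (ℕ →ᵇ A) where
  carrier := {a | Tendsto (fun n => ‖a n‖) (ω : Filter ℕ) (𝓝 0)}
  zero_mem' := by simp
  add_mem' {a b} ha hb := by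
    have h : Tendsto (fun n => ‖a n‖ + ‖b n‖) (ω : Filter ℕ) (𝓝 0) := by
      simpa using Tendsto.add ha hb
    exact squeeze_zero (fun n => norm_nonneg _) (fun n => norm_add_le (a n) (b n)) h
  smul_mem' c a ha := by
    have h : Tendsto (fun n => ‖c‖ * ‖a n‖) (ω : Filter ℕ) (𝓝 0) := by
      simpa using Tendsto.const_mul ‖c‖ ha
    refine squeeze_zero (fun n => norm_nonneg _) (fun n => ?_) h
    exact (norm_mul_le (c n) (a n)).trans
      (mul_le_mul_of_nonneg_right (c.norm_coe_le_norm n) (norm_nonneg _))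

section Ultra

variable {ω : Ultrafilter ℕ} {A : Type*} [CStarAlgebra A]

theorem mem_ultraNull {a : ℕ →ᵇ A} :
    a ∈ ultraNull ω A ↔ Tendsto (fun n => ‖a n‖) (ω : Filter ℕ) (𝓝 0) := Iff.rfl

theorem star_mem_ultraNull {a : ℕ →ᵇ A} (ha : a ∈ ultraNull ω A) : star a ∈ ultraNull ω A := by
  simpa [mem_ultraNull] using ha

instance ultraNull.isTwoSided : (ultraNull ω A).IsTwoSided where
  mul_mem_of_left {a} c ha := by
    have : star (star c * star a) ∈ ultraNull ω A :=
      star_mem_ultraNull ((ultraNull ω A).mul_mem_left _ (star_mem_ultraNull ha))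
    simpa using this

instance ultraNull.isClosed : IsClosed ((ultraNull ω A : Ideal (ℕ →ᵇ A)) : Set (ℕ →ᵇ A)) := by
  rw [← isSeqClosed_iff_isClosed]
  intro u a hu ha
  rw [SetLike.mem_coe, mem_ultraNull, Metric.tendsto_nhds]
  intro ε hε
  obtain ⟨k, hk⟩ := ((Metric.tendsto_nhds.1 ha) (ε / 2) (half_pos hε)).exists
  have h := (Metric.tendsto_nhds.1 (mem_ultraNull.1 (hu k))) (ε / 2) (half_pos hε)
  filter_upwards [h] with n hn
  simp only [dist_zero_right, norm_norm] at hn ⊢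
  have h1 : dist (u k n) (a n) ≤ dist (u k) a := BoundedContinuousFunction.dist_coe_le_dist n
  rw [dist_eq_norm] at h1
  have h2 : ‖a n‖ ≤ ‖u k n‖ + ‖u k n - a n‖ := by
    have := norm_sub_le (u k n) (u k n - a n); simpa using this
  linarith

end Ultra

/-- The ultrapower `A_ω = ℓ^∞(ℕ, A) / c_ω(ℕ, A)`. -/
def CStarUltrapower (ω : Ultrafilter ℕ) (A : Type*) [CStarAlgebra A] : Type _ :=
  (ℕ →ᵇ A) ⧸ ultraNull ω A

namespace CStarUltrapower

variable {ω : Ultrafilter ℕ} {A : Type*} [CStarAlgebra A]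

instance : Ring (CStarUltrapower ω A) := inferInstanceAs (Ring ((ℕ →ᵇ A) ⧸ ultraNull ω A))

instance : Algebra ℂ (CStarUltrapower ω A) :=
  inferInstanceAs (Algebra ℂ ((ℕ →ᵇ A) ⧸ ultraNull ω A))

instance : NormedAddCommGroup (CStarUltrapower ω A) :=
  inferInstanceAs (NormedAddCommGroup ((ℕ →ᵇ A) ⧸ ultraNull ω A))

instance : CompleteSpace (CStarUltrapower ω A) :=
  inferInstanceAs (CompleteSpace ((ℕ →ᵇ A) ⧸ ultraNull ω A))

variable (ω A) in
/-- The quotient map `π_ω`. -/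
def mk : (ℕ →ᵇ A) →ₐ[ℂ] CStarUltrapower ω A := Ideal.Quotient.mkₐ ℂ (ultraNull ω A)

theorem mk_surjective : Function.Surjective (mk ω A) := Ideal.Quotient.mk_surjective

theorem mk_eq_zero {a : ℕ →ᵇ A} : mk ω A a = 0 ↔ a ∈ ultraNull ω A :=
  Ideal.Quotient.eq_zero_iff_mem

theorem mk_eq_mk {a b : ℕ →ᵇ A} : mk ω A a = mk ω A b ↔ a - b ∈ ultraNull ω A := by
  rw [← mk_eq_zero, map_sub, sub_eq_zero]

theorem norm_mk_le (a : ℕ →ᵇ A) : ‖mk ω A a‖ ≤ ‖a‖ :=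
  Submodule.Quotient.norm_mk_le (ultraNull ω A) a

theorem exists_norm_lt (x : CStarUltrapower ω A) {ε : ℝ} (hε : 0 < ε) :
    ∃ a, mk ω A a = x ∧ ‖a‖ < ‖x‖ + ε :=
  Submodule.Quotient.norm_mk_lt (S := ultraNull ω A) x hε

/-- The quotient norm is the limit of the norms along `ω`. -/
theorem tendsto_norm (a : ℕ →ᵇ A) :
    Tendsto (fun n => ‖a n‖) (ω : Filter ℕ) (𝓝 ‖mk ω A a‖) := by
  rw [tendsto_order]
  constructor
  · intro r hr
    by_contra hcon
    have hS : ∀ᶠ n in (ω : Filter ℕ), ‖a n‖ ≤ r := by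
      have := Ultrafilter.eventually_not.2 hcon
      filter_upwards [this] with n hn using not_lt.1 hn
    have hr0 : 0 ≤ r := by
      obtain ⟨n, hn⟩ := hS.exists
      exact (norm_nonneg _).trans hn
    let b : ℕ →ᵇ A := BoundedContinuousFunction.ofNormedAddCommGroupDiscrete
      (fun n => if ‖a n‖ ≤ r then a n else 0) r (fun n => by
        by_cases h : ‖a n‖ ≤ r <;> simp [h, hr0])
    have hab : mk ω A a = mk ω A b := by
      rw [mk_eq_mk, mem_ultraNull]
      refine tendsto_const_nhds.congr' ?_
      filter_upwards [hS] with n hn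
      simp [b, hn]
    have hb : ‖b‖ ≤ r := by
      rw [BoundedContinuousFunction.norm_le hr0]
      intro n
      by_cases h : ‖a n‖ ≤ r <;> simp [b, h, hr0]
    exact absurd hr (not_lt.2 (hab ▸ (norm_mk_le b).trans hb))
  · intro r hr
    obtain ⟨b, hb, hlt⟩ := exists_norm_lt (mk ω A a) (half_pos (sub_pos.2 hr))
    have h := mem_ultraNull.1 (mk_eq_mk.1 hb.symm)
    have h2 := (Metric.tendsto_nhds.1 h) _ (half_pos (sub_pos.2 hr))
    filter_upwards [h2] with n hn
    simp only [dist_zero_right, norm_norm, BoundedContinuousFunction.coe_sub,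
      Pi.sub_apply] at hn
    have h3 : ‖a n‖ ≤ ‖a n - b n‖ + ‖b n‖ := by
      simpa using norm_add_le (a n - b n) (b n)
    have h4 := b.norm_coe_le_norm n
    linarith

theorem norm_eq_of_tendsto {a : ℕ →ᵇ A} {r : ℝ}
    (h : Tendsto (fun n => ‖a n‖) (ω : Filter ℕ) (𝓝 r)) : ‖mk ω A a‖ = r :=
  tendsto_nhds_unique (tendsto_norm a) h

instance : NormedRing (CStarUltrapower ω A) where
  __ : NormedAddCommGroup (CStarUltrapower ω A) := inferInstance
  __ : Ring (CStarUltrapower ω A) := inferInstance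
  norm_mul_le x y := by
    obtain ⟨a, rfl⟩ := mk_surjective x
    obtain ⟨b, rfl⟩ := mk_surjective y
    rw [← map_mul]
    exact le_of_tendsto_of_tendsto' (tendsto_norm (a * b))
      ((tendsto_norm a).mul (tendsto_norm b)) (fun n => norm_mul_le (a n) (b n))

instance : NormedAlgebra ℂ (CStarUltrapower ω A) where
  __ : Algebra ℂ (CStarUltrapower ω A) := inferInstance
  norm_smul_le c x := by
    obtain ⟨a, rfl⟩ := mk_surjective x
    rw [← map_smul]
    refine le_of_tendsto_of_tendsto' (tendsto_norm (c • a))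
      ((tendsto_norm a).const_mul ‖c‖) (fun n => norm_smul_le c (a n))

instance : StarRing (CStarUltrapower ω A) where
  star := Quotient.map' star (fun a b h => by
    rw [Submodule.quotientRel_def] at h ⊢
    rw [← star_sub]
    exact star_mem_ultraNull h)
  star_involutive x := by
    obtain ⟨a, rfl⟩ := mk_surjective x
    exact congrArg (mk ω A) (star_star a)
  star_mul x y := by
    obtain ⟨a, rfl⟩ := mk_surjective x
    obtain ⟨b, rfl⟩ := mk_surjective y
    exact congrArg (mk ω A) (star_mul a b)
  star_add x y := by
    obtain ⟨a, rfl⟩ := mk_surjective x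
    obtain ⟨b, rfl⟩ := mk_surjective y
    exact congrArg (mk ω A) (star_add a b)

theorem mk_star (a : ℕ →ᵇ A) : mk ω A (star a) = star (mk ω A a) := rfl

instance : CStarAlgebra (CStarUltrapower ω A) where
  star_smul c x := by
    obtain ⟨a, rfl⟩ := mk_surjective x
    rw [← map_smul, ← mk_star, star_smul, map_smul, mk_star]
  norm_mul_self_le x := by
    obtain ⟨a, rfl⟩ := mk_surjective x
    rw [← mk_star, ← map_mul]
    refine le_of_tendsto_of_tendsto' ((tendsto_norm a).mul (tendsto_norm a))
      (tendsto_norm (star a * a)) (fun n => ?_)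
    exact CStarRing.norm_mul_self_le (a n)

instance : PartialOrder (CStarUltrapower ω A) := CStarAlgebra.spectralOrder _

instance : StarOrderedRing (CStarUltrapower ω A) := CStarAlgebra.spectralOrderedRing _

variable (ω A) in
/-- The embedding `ι : A → A_ω` as constant sequences. -/
def const : A →⋆ₐ[ℂ] CStarUltrapower ω A where
  toFun a := mk ω A (BoundedContinuousFunction.const ℕ a)
  map_one' := map_one (mk ω A)
  map_mul' a b := map_mul (mk ω A) (BoundedContinuousFunction.const ℕ a) (.const ℕ b)
  map_zero' := map_zero (mk ω A)
  map_add' a b := map_add (mk ω A) (BoundedContinuousFunction.const ℕ a) (.const ℕ b)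
  commutes' r := (mk ω A).commutes r
  map_star' _ := rfl

variable (ω A) in
/-- The central ultrapower algebra `A_ω ∩ A'`. -/
def central : StarSubalgebra ℂ (CStarUltrapower ω A) :=
  StarSubalgebra.centralizer ℂ (Set.range (const ω A))

/-- Entrywise application of a `*`-homomorphism to a bounded sequence. -/
def seqMap {B : Type*} [CStarAlgebra B] (α : A →⋆ₐ[ℂ] B) : (ℕ →ᵇ A) →⋆ₐ[ℂ] (ℕ →ᵇ B) where
  toFun a := BoundedContinuousFunction.ofNormedAddCommGroupDiscrete (fun n => α (a n)) ‖a‖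
    (fun n => (NonUnitalStarAlgHom.norm_apply_le α (a n)).trans (a.norm_coe_le_norm n))
  map_one' := by ext n; exact map_one α
  map_mul' a b := by ext n; exact map_mul α (a n) (b n)
  map_zero' := by ext n; exact map_zero α
  map_add' a b := by ext n; exact map_add α (a n) (b n)
  commutes' r := by ext n; exact AlgHomClass.commutes α r
  map_star' a := by ext n; exact map_star α (a n)

theorem seqMap_mem {B : Type*} [CStarAlgebra B] (α : A →⋆ₐ[ℂ] B) {a : ℕ →ᵇ A}
    (ha : a ∈ ultraNull ω A) : seqMap α a ∈ ultraNull ω B :=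
  squeeze_zero (fun _ => norm_nonneg _)
    (fun n => NonUnitalStarAlgHom.norm_apply_le α (a n)) ha

variable (ω) in
/-- The `*`-homomorphism `α_ω : A_ω → B_ω`, `[(a_n)] ↦ [(α a_n)]`. -/
def map {B : Type*} [CStarAlgebra B] (α : A →⋆ₐ[ℂ] B) : CStarUltrapower ω A →⋆ₐ[ℂ] CStarUltrapower ω B where
  __ := Ideal.Quotient.liftₐ (ultraNull ω A) ((mk ω B).comp (seqMap α : (ℕ →ᵇ A) →ₐ[ℂ] (ℕ →ᵇ B)))
    (fun _ ha => mk_eq_zero.2 (seqMap_mem α ha))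
  map_star' x := by
    obtain ⟨a, rfl⟩ := mk_surjective x
    exact congrArg (mk ω B) (map_star (seqMap α) a)

theorem map_mk {B : Type*} [CStarAlgebra B] (α : A →⋆ₐ[ℂ] B) (a : ℕ →ᵇ A) :
    map ω α (mk ω A a) = mk ω B (seqMap α a) := rfl

end CStarUltrapower

/-- A `C*`-seminorm on a complex unital `*`-algebra. -/
structure IsCStarSeminorm {E : Type*} [Ring E] [StarRing E] [Algebra ℂ E] (p : Seminorm ℂ E) :
    Prop where
  mul_le : ∀ x y, p (x * y) ≤ p x * p y
  star_mul_self : ∀ x, p (star x * x) = p x * p x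

namespace IsCStarSeminorm

variable {E : Type*} [Ring E] [StarRing E] [Algebra ℂ E] {p : Seminorm ℂ E}

theorem zero : IsCStarSeminorm (0 : Seminorm ℂ E) where
  mul_le _ _ := by simp
  star_mul_self _ := by simp

theorem map_one_le (hp : IsCStarSeminorm p) : p 1 ≤ 1 := by
  have h := hp.star_mul_self 1
  simp only [star_one, mul_one] at h
  nlinarith [apply_nonneg p 1]

theorem le_map_star (hp : IsCStarSeminorm p) (x : E) : p x ≤ p (star x) := by
  rcases (apply_nonneg p x).eq_or_lt with h | h
  · rw [← h]; exact apply_nonneg p _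
  · have h1 := hp.star_mul_self x
    have h2 := hp.mul_le (star x) x
    rw [h1] at h2
    exact le_of_mul_le_mul_right h2 h

theorem map_star (hp : IsCStarSeminorm p) (x : E) : p (star x) = p x :=
  le_antisymm (by simpa using hp.le_map_star (star x)) (hp.le_map_star x)

theorem bound (hp : IsCStarSeminorm p) {A : Type*} [CStarAlgebra A] (f : A →ₐ[ℂ] E)
    (hf : ∀ a, f (star a) = star (f a)) (a : A) : p (f a) ≤ 2 * ‖a‖ := by
  obtain ⟨u, c, h, hc⟩ := CStarAlgebra.exists_sum_four_unitary a
  have hu : ∀ i, p (f (u i)) ≤ 1 := fun i => by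
    have h1 := hp.star_mul_self (f (u i))
    rw [← hf, ← map_mul, Unitary.coe_star_mul_self, map_one] at h1
    nlinarith [apply_nonneg p (f (u i)), hp.map_one_le]
  have h2 : p (f a) ≤ ∑ i, ‖c i‖ * p (f (u i)) := by
    conv_lhs => rw [h, map_sum]
    simp only [map_smul, ← map_smul_eq_mul p]
    exact Finset.le_sum_of_subadditive p (map_zero p).le (map_add_le_add p) _ _
  refine h2.trans ?_
  calc ∑ i, ‖c i‖ * p (f (u i)) ≤ ∑ _i : Fin 4, ‖a‖ / 2 * 1 :=
        Finset.sum_le_sum fun i _ => mul_le_mul (hc i) (hu i) (apply_nonneg p _) (by positivity)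
    _ = 2 * ‖a‖ := by simp; ring

end IsCStarSeminorm

section MaxNorm

variable {A C : Type*} [CStarAlgebra A] [CStarAlgebra C]

theorem bddAbove_cstarSeminorm (x : A ⊗[ℂ] C) : BddAbove
    (Set.range fun p : {p : Seminorm ℂ (A ⊗[ℂ] C) // IsCStarSeminorm p} => p.1 x) := by
  suffices h : ∃ M, ∀ p : Seminorm ℂ (A ⊗[ℂ] C), IsCStarSeminorm p → p x ≤ M by
    obtain ⟨M, hM⟩ := h
    exact ⟨M, by rintro _ ⟨p, rfl⟩; exact hM p.1 p.2⟩
  induction x using TensorProduct.induction_on with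
  | zero => exact ⟨0, fun p _ => by simp⟩
  | tmul a c =>
    refine ⟨2 * ‖a‖ * (2 * ‖c‖), fun p hp => ?_⟩
    have h1 := hp.bound (Algebra.TensorProduct.includeLeft : A →ₐ[ℂ] A ⊗[ℂ] C)
      (fun a => by simp) a
    have h2 := hp.bound (Algebra.TensorProduct.includeRight : C →ₐ[ℂ] A ⊗[ℂ] C)
      (fun a => by simp) c
    have h3 := hp.mul_le (a ⊗ₜ[ℂ] (1 : C)) ((1 : A) ⊗ₜ[ℂ] c)
    simp only [Algebra.TensorProduct.tmul_mul_tmul, mul_one, one_mul] at h3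
    exact h3.trans (mul_le_mul h1 h2 (apply_nonneg p _) (by positivity))
  | add x y hx hy =>
    obtain ⟨M, hM⟩ := hx
    obtain ⟨N, hN⟩ := hy
    exact ⟨M + N, fun p hp => (map_add_le_add p x y).trans (add_le_add (hM p hp) (hN p hp))⟩

variable (A C) in
/-- The maximal `C*`-seminorm on the algebraic tensor product `A ⊙ C`: the supremum of all
`C*`-seminorms. -/
def maxCStarSeminorm : Seminorm ℂ (A ⊗[ℂ] C) :=
  haveI : Nonempty {p : Seminorm ℂ (A ⊗[ℂ] C) // IsCStarSeminorm p} := ⟨⟨0, .zero⟩⟩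
  Seminorm.of (fun x => ⨆ p : {p : Seminorm ℂ (A ⊗[ℂ] C) // IsCStarSeminorm p}, p.1 x)
    (fun x y => ciSup_le fun p => (map_add_le_add p.1 x y).trans
      (add_le_add (le_ciSup (bddAbove_cstarSeminorm x) p) (le_ciSup (bddAbove_cstarSeminorm y) p)))
    (fun c x => by
      simp only [map_smul_eq_mul]
      rw [Real.mul_iSup_of_nonneg (norm_nonneg c)])

theorem maxCStarSeminorm_apply (x : A ⊗[ℂ] C) : maxCStarSeminorm A C x =
    ⨆ p : {p : Seminorm ℂ (A ⊗[ℂ] C) // IsCStarSeminorm p}, p.1 x := rfl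

theorem IsCStarSeminorm.le_max {p : Seminorm ℂ (A ⊗[ℂ] C)} (hp : IsCStarSeminorm p)
    (x : A ⊗[ℂ] C) : p x ≤ maxCStarSeminorm A C x :=
  le_ciSup (bddAbove_cstarSeminorm x) ⟨p, hp⟩

theorem maxCStarSeminorm_le {x : A ⊗[ℂ] C} {r : ℝ}
    (h : ∀ p : Seminorm ℂ (A ⊗[ℂ] C), IsCStarSeminorm p → p x ≤ r) :
    maxCStarSeminorm A C x ≤ r :=
  haveI : Nonempty {p : Seminorm ℂ (A ⊗[ℂ] C) // IsCStarSeminorm p} := ⟨⟨0, .zero⟩⟩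
  ciSup_le fun p => h p.1 p.2

theorem isCStarSeminorm_max : IsCStarSeminorm (maxCStarSeminorm A C) where
  mul_le x y := maxCStarSeminorm_le fun p hp => (hp.mul_le x y).trans
    (mul_le_mul (hp.le_max x) (hp.le_max y) (apply_nonneg p _) (apply_nonneg _ _))
  star_mul_self x := by
    refine le_antisymm (maxCStarSeminorm_le fun p hp => ?_) ?_
    · rw [hp.star_mul_self]
      exact mul_le_mul (hp.le_max x) (hp.le_max x) (apply_nonneg p _) (apply_nonneg _ _)
    · have h : maxCStarSeminorm A C x ≤ √(maxCStarSeminorm A C (star x * x)) :=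
        maxCStarSeminorm_le fun p hp => Real.le_sqrt_of_sq_le (by
          rw [sq, ← hp.star_mul_self]; exact hp.le_max _)
      calc _ ≤ √(maxCStarSeminorm A C (star x * x)) * √(maxCStarSeminorm A C (star x * x)) :=
            mul_le_mul h h (apply_nonneg _ _) (Real.sqrt_nonneg _)
        _ = _ := Real.mul_self_sqrt (apply_nonneg _ _)

end MaxNorm

/-- The algebraic tensor product, as a type to carry the maximal `C*`-seminorm. -/
def PreMaxTensor (A C : Type*) [CStarAlgebra A] [CStarAlgebra C] : Type _ := A ⊗[ℂ] C

namespace PreMaxTensor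

variable {A C : Type*} [CStarAlgebra A] [CStarAlgebra C]

instance : Ring (PreMaxTensor A C) := inferInstanceAs (Ring (A ⊗[ℂ] C))
instance : StarRing (PreMaxTensor A C) := inferInstanceAs (StarRing (A ⊗[ℂ] C))
instance : Algebra ℂ (PreMaxTensor A C) := inferInstanceAs (Algebra ℂ (A ⊗[ℂ] C))
instance : StarModule ℂ (PreMaxTensor A C) := inferInstanceAs (StarModule ℂ (A ⊗[ℂ] C))

variable (A C) in
/-- The maximal `C*`-seminorm as an additive group seminorm. -/
def groupSeminorm : AddGroupSeminorm (PreMaxTensor A C) where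
  toFun x := maxCStarSeminorm A C x
  map_zero' := map_zero (maxCStarSeminorm A C)
  add_le' x y := map_add_le_add (maxCStarSeminorm A C) x y
  neg' x := map_neg_eq_map (maxCStarSeminorm A C) x

instance : SeminormedRing (PreMaxTensor A C) where
  __ : SeminormedAddCommGroup (PreMaxTensor A C) := (groupSeminorm A C).toSeminormedAddCommGroup
  __ : Ring (PreMaxTensor A C) := inferInstance
  norm_mul_le x y := isCStarSeminorm_max.mul_le x y

theorem norm_def (x : PreMaxTensor A C) : ‖x‖ = maxCStarSeminorm A C x := rfl

instance : NormedAlgebra ℂ (PreMaxTensor A C) where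
  __ : Algebra ℂ (PreMaxTensor A C) := inferInstance
  norm_smul_le c x := (map_smul_eq_mul (maxCStarSeminorm A C) c x).le

theorem norm_star (x : PreMaxTensor A C) : ‖star x‖ = ‖x‖ := isCStarSeminorm_max.map_star x

theorem norm_star_mul_self (x : PreMaxTensor A C) : ‖star x * x‖ = ‖x‖ * ‖x‖ :=
  isCStarSeminorm_max.star_mul_self x

theorem uniformContinuous_star : UniformContinuous (star : PreMaxTensor A C → PreMaxTensor A C) :=
  (AddMonoidHomClass.isometry_of_norm (starAddEquiv : PreMaxTensor A C ≃+ PreMaxTensor A C)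
    norm_star).uniformContinuous

end PreMaxTensor

open UniformSpace

/-- The maximal tensor product `A ⊗_max C`: the Hausdorff completion of the algebraic tensor
product in the maximal `C*`-seminorm. -/
def MaxTensor (A C : Type*) [CStarAlgebra A] [CStarAlgebra C] : Type _ :=
  Completion (PreMaxTensor A C)

namespace MaxTensor

variable {A C : Type*} [CStarAlgebra A] [CStarAlgebra C]

instance : NormedRing (MaxTensor A C) := inferInstanceAs (NormedRing (Completion (PreMaxTensor A C)))

instance : CompleteSpace (MaxTensor A C) :=
  inferInstanceAs (CompleteSpace (Completion (PreMaxTensor A C)))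

instance : Algebra ℂ (MaxTensor A C) :=
  inferInstanceAs (Algebra ℂ (Completion (PreMaxTensor A C)))

variable (A C) in
/-- The canonical map from the algebraic tensor product. -/
def ofAlg : A ⊗[ℂ] C →ₐ[ℂ] MaxTensor A C where
  toFun x := ((show PreMaxTensor A C from x) : Completion (PreMaxTensor A C))
  map_one' := Completion.coe_one _
  map_mul' x y := Completion.coe_mul (α := PreMaxTensor A C) x y
  map_zero' := Completion.coe_zero
  map_add' x y := Completion.coe_add (α := PreMaxTensor A C) x y
  commutes' _ := rfl

theorem norm_ofAlg (x : A ⊗[ℂ] C) : ‖ofAlg A C x‖ = maxCStarSeminorm A C x :=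
  Completion.norm_coe (E := PreMaxTensor A C) x

theorem denseRange_ofAlg : DenseRange (ofAlg A C) :=
  Completion.denseRange_coe (α := PreMaxTensor A C)

instance : NormedAlgebra ℂ (MaxTensor A C) where
  __ : Algebra ℂ (MaxTensor A C) := inferInstance
  norm_smul_le c x := by
    refine denseRange_ofAlg.induction_on x (isClosed_le ?_ (by fun_prop)) fun a => ?_
    · simp only [Algebra.smul_def]; fun_prop
    · rw [← map_smul, norm_ofAlg, norm_ofAlg, map_smul_eq_mul]

instance : Star (MaxTensor A C) where
  star := Completion.map (star : PreMaxTensor A C → PreMaxTensor A C)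

theorem continuous_star : Continuous (star : MaxTensor A C → MaxTensor A C) :=
  Completion.continuous_map

theorem ofAlg_star (x : A ⊗[ℂ] C) : ofAlg A C (star x) = star (ofAlg A C x) :=
  (Completion.map_coe (PreMaxTensor.uniformContinuous_star (A := A) (C := C)) x).symm

theorem induction₂ {P : MaxTensor A C → MaxTensor A C → Prop}
    (hP : IsClosed {z : MaxTensor A C × MaxTensor A C | P z.1 z.2})
    (h : ∀ x y, P (ofAlg A C x) (ofAlg A C y)) (x y : MaxTensor A C) : P x y :=
  Completion.induction_on₂ (α := PreMaxTensor A C) (β := PreMaxTensor A C) x y hP h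

instance : StarRing (MaxTensor A C) where
  star_involutive x := by
    refine denseRange_ofAlg.induction_on x
      (isClosed_eq (continuous_star.comp continuous_star) continuous_id) fun a => ?_
    rw [← ofAlg_star, ← ofAlg_star, star_star]
  star_mul x y := by
    have h1 : Continuous fun z : MaxTensor A C × MaxTensor A C => star z.2 * star z.1 :=
      (continuous_star.comp continuous_snd).mul (continuous_star.comp continuous_fst)
    refine induction₂ (P := fun x y => star (x * y) = star y * star x)
      (isClosed_eq (continuous_star.comp continuous_mul) h1) ?_ x y
    intro a b
    rw [← map_mul, ← ofAlg_star, ← ofAlg_star, ← ofAlg_star, star_mul, map_mul]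
  star_add x y := by
    have h1 : Continuous fun z : MaxTensor A C × MaxTensor A C => star z.1 + star z.2 :=
      (continuous_star.comp continuous_fst).add (continuous_star.comp continuous_snd)
    refine induction₂ (P := fun x y => star (x + y) = star x + star y)
      (isClosed_eq (continuous_star.comp continuous_add) h1) ?_ x y
    intro a b
    rw [← map_add, ← ofAlg_star, ← ofAlg_star, ← ofAlg_star, star_add, map_add]

instance : CStarAlgebra (MaxTensor A C) where
  star_smul c x := by
    refine denseRange_ofAlg.induction_on x (isClosed_eq (continuous_star.comp
      (continuous_const_smul c)) (continuous_star.const_smul (star c))) fun a => ?_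
    rw [← map_smul, ← ofAlg_star, ← ofAlg_star, star_smul, map_smul]
  norm_mul_self_le x := by
    refine denseRange_ofAlg.induction_on x (isClosed_le (by fun_prop)
      ((continuous_star.mul continuous_id).norm)) fun a => ?_
    rw [← ofAlg_star, ← map_mul, norm_ofAlg, norm_ofAlg, isCStarSeminorm_max.star_mul_self]

instance : PartialOrder (MaxTensor A C) := CStarAlgebra.spectralOrder _

instance : StarOrderedRing (MaxTensor A C) := CStarAlgebra.spectralOrderedRing _

variable (A C) in
/-- The first factor embedding `id_A ⊗ 1_C : a ↦ a ⊗ 1`. -/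
def inl : A →⋆ₐ[ℂ] MaxTensor A C where
  __ := (ofAlg A C).comp (Algebra.TensorProduct.includeLeft : A →ₐ[ℂ] A ⊗[ℂ] C)
  map_star' a := by
    refine Eq.trans (congrArg (ofAlg A C) ?_) (ofAlg_star (a ⊗ₜ[ℂ] (1 : C)))
    simp

variable (A C) in
/-- The second factor embedding `c ↦ 1 ⊗ c`. -/
def inr : C →⋆ₐ[ℂ] MaxTensor A C where
  __ := (ofAlg A C).comp (Algebra.TensorProduct.includeRight : C →ₐ[ℂ] A ⊗[ℂ] C)
  map_star' a := by
    refine Eq.trans (congrArg (ofAlg A C) ?_) (ofAlg_star ((1 : A) ⊗ₜ[ℂ] a))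
    simp

theorem ofAlg_tmul (a : A) (c : C) : ofAlg A C (a ⊗ₜ[ℂ] c) = inl A C a * inr A C c := by
  refine Eq.trans ?_ (map_mul (ofAlg A C) (a ⊗ₜ[ℂ] (1 : C)) ((1 : A) ⊗ₜ[ℂ] c))
  simp

/-- The algebraic tensor product of two `*`-homomorphisms. -/
def algMap {A' C' : Type*} [CStarAlgebra A'] [CStarAlgebra C'] (α : A →⋆ₐ[ℂ] A')
    (γ : C →⋆ₐ[ℂ] C') : A ⊗[ℂ] C →ₐ[ℂ] A' ⊗[ℂ] C' :=
  Algebra.TensorProduct.map (α : A →ₐ[ℂ] A') (γ : C →ₐ[ℂ] C')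

theorem algMap_star {A' C' : Type*} [CStarAlgebra A'] [CStarAlgebra C'] (α : A →⋆ₐ[ℂ] A')
    (γ : C →⋆ₐ[ℂ] C') (x : A ⊗[ℂ] C) : algMap α γ (star x) = star (algMap α γ x) := by
  induction x using TensorProduct.induction_on with
  | zero => simp
  | tmul a c => simp [algMap, map_star]
  | add x y hx hy => simp [hx, hy]

theorem maxCStarSeminorm_algMap_le {A' C' : Type*} [CStarAlgebra A'] [CStarAlgebra C']
    (α : A →⋆ₐ[ℂ] A') (γ : C →⋆ₐ[ℂ] C') (x : A ⊗[ℂ] C) :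
    maxCStarSeminorm A' C' (algMap α γ x) ≤ maxCStarSeminorm A C x :=
  IsCStarSeminorm.le_max (p := (maxCStarSeminorm A' C').comp (algMap α γ).toLinearMap)
    { mul_le := fun x y => by
        simpa using isCStarSeminorm_max.mul_le (algMap α γ x) (algMap α γ y)
      star_mul_self := fun x => by
        simpa [algMap_star] using isCStarSeminorm_max.star_mul_self (algMap α γ x) } x

/-- `algMap α γ`, as a map of seminormed rings. -/
def preMap {A' C' : Type*} [CStarAlgebra A'] [CStarAlgebra C'] (α : A →⋆ₐ[ℂ] A')
    (γ : C →⋆ₐ[ℂ] C') : PreMaxTensor A C →+* PreMaxTensor A' C' := (algMap α γ).toRingHom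

theorem continuous_preMap {A' C' : Type*} [CStarAlgebra A'] [CStarAlgebra C'] (α : A →⋆ₐ[ℂ] A')
    (γ : C →⋆ₐ[ℂ] C') : Continuous (preMap α γ) :=
  AddMonoidHomClass.continuous_of_bound (preMap α γ) 1 fun x => by
    rw [one_mul]; exact maxCStarSeminorm_algMap_le α γ x

/-- The extension of `algMap α γ` to the completions, as a ring homomorphism. -/
def mapRing {A' C' : Type*} [CStarAlgebra A'] [CStarAlgebra C'] (α : A →⋆ₐ[ℂ] A')
    (γ : C →⋆ₐ[ℂ] C') : MaxTensor A C →+* MaxTensor A' C' :=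
  Completion.mapRingHom (preMap α γ) (continuous_preMap α γ)

theorem continuous_mapRing {A' C' : Type*} [CStarAlgebra A'] [CStarAlgebra C'] (α : A →⋆ₐ[ℂ] A')
    (γ : C →⋆ₐ[ℂ] C') : Continuous (mapRing α γ) :=
  Completion.continuous_map (f := preMap α γ)

theorem mapRing_ofAlg {A' C' : Type*} [CStarAlgebra A'] [CStarAlgebra C'] (α : A →⋆ₐ[ℂ] A')
    (γ : C →⋆ₐ[ℂ] C') (x : A ⊗[ℂ] C) : mapRing α γ (ofAlg A C x) = ofAlg A' C' (algMap α γ x) :=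
  Completion.mapRingHom_coe (continuous_preMap α γ) x

/-- The `*`-homomorphism `α ⊗ γ` between maximal tensor products. -/
def map {A' C' : Type*} [CStarAlgebra A'] [CStarAlgebra C'] (α : A →⋆ₐ[ℂ] A')
    (γ : C →⋆ₐ[ℂ] C') : MaxTensor A C →⋆ₐ[ℂ] MaxTensor A' C' where
  __ := mapRing α γ
  commutes' r := by
    refine (congrArg (mapRing α γ) ((ofAlg A C).commutes r).symm).trans ?_
    rw [mapRing_ofAlg, AlgHom.commutes, AlgHom.commutes]
  map_star' x := by
    refine denseRange_ofAlg.induction_on x (isClosed_eq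
      ((continuous_mapRing α γ).comp continuous_star)
      (continuous_star.comp (continuous_mapRing α γ))) fun a => ?_
    change mapRing α γ (star (ofAlg A C a)) = star (mapRing α γ (ofAlg A C a))
    rw [← ofAlg_star, mapRing_ofAlg, mapRing_ofAlg, algMap_star, ofAlg_star]

theorem map_ofAlg {A' C' : Type*} [CStarAlgebra A'] [CStarAlgebra C'] (α : A →⋆ₐ[ℂ] A')
    (γ : C →⋆ₐ[ℂ] C') (x : A ⊗[ℂ] C) : map α γ (ofAlg A C x) = ofAlg A' C' (algMap α γ x) :=
  mapRing_ofAlg α γ x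

theorem map_ofAlg_tmul {A' C' : Type*} [CStarAlgebra A'] [CStarAlgebra C'] (α : A →⋆ₐ[ℂ] A')
    (γ : C →⋆ₐ[ℂ] C') (a : A) (c : C) :
    map α γ (ofAlg A C (a ⊗ₜ[ℂ] c)) = ofAlg A' C' (α a ⊗ₜ[ℂ] γ c) := by
  rw [map_ofAlg]; rfl

theorem continuous_map {A' C' : Type*} [CStarAlgebra A'] [CStarAlgebra C'] (α : A →⋆ₐ[ℂ] A')
    (γ : C →⋆ₐ[ℂ] C') : Continuous (map α γ) := continuous_mapRing α γ

/-- `*`-homomorphisms out of `A ⊗_max C` agree if they agree on elementary tensors. -/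
theorem hom_ext {D : Type*} [CStarAlgebra D] {f g : MaxTensor A C →⋆ₐ[ℂ] D}
    (h : ∀ a c, f (ofAlg A C (a ⊗ₜ[ℂ] c)) = g (ofAlg A C (a ⊗ₜ[ℂ] c))) (x : MaxTensor A C) :
    f x = g x := by
  have hf : Continuous f := AddMonoidHomClass.continuous_of_bound f 1 fun x => by
    simpa using NonUnitalStarAlgHom.norm_apply_le f x
  have hg : Continuous g := AddMonoidHomClass.continuous_of_bound g 1 fun x => by
    simpa using NonUnitalStarAlgHom.norm_apply_le g x
  refine denseRange_ofAlg.induction_on x (isClosed_eq hf hg) fun y => ?_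
  induction y using TensorProduct.induction_on with
  | zero => simp
  | tmul a c => exact h a c
  | add x y hx hy => simp only [map_add, hx, hy]

end MaxTensor

/-- A continuous action of a topological group on a unital `C*`-algebra by `*`-automorphisms:
for each `a`, the map `g ↦ α_g(a)` is norm continuous. -/
structure CStarAction (G A : Type*) [Group G] [TopologicalSpace G] [CStarAlgebra A] where
  /-- The automorphisms `α_g`. -/
  aut : G →* (A ≃⋆ₐ[ℂ] A)
  continuous_apply : ∀ a, Continuous fun g => aut g a

namespace CStarAction

variable {G A C : Type*} [Group G] [TopologicalSpace G] [CStarAlgebra A] [CStarAlgebra C]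

/-- The `*`-homomorphism `α_g`. -/
def hom (α : CStarAction G A) (g : G) : A →⋆ₐ[ℂ] A := (α.aut g : A →⋆ₐ[ℂ] A)

theorem hom_apply (α : CStarAction G A) (g : G) (a : A) : α.hom g a = α.aut g a := rfl

theorem map_hom_mul (α : CStarAction G A) (β : CStarAction G C) (g h : G) (x : MaxTensor A C) :
    MaxTensor.map (α.hom (g * h)) (β.hom (g * h)) x =
      MaxTensor.map (α.hom g) (β.hom g) (MaxTensor.map (α.hom h) (β.hom h) x) :=
  MaxTensor.hom_ext (f := MaxTensor.map (α.hom (g * h)) (β.hom (g * h)))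
    (g := (MaxTensor.map (α.hom g) (β.hom g)).comp (MaxTensor.map (α.hom h) (β.hom h)))
    (fun a c => by
      simp only [StarAlgHom.comp_apply, MaxTensor.map_ofAlg_tmul, hom_apply, map_mul,
        StarAlgEquiv.mul_apply]) x

theorem map_hom_one (α : CStarAction G A) (β : CStarAction G C) (x : MaxTensor A C) :
    MaxTensor.map (α.hom 1) (β.hom 1) x = x :=
  MaxTensor.hom_ext (f := MaxTensor.map (α.hom 1) (β.hom 1)) (g := StarAlgHom.id ℂ _)
    (fun a c => by
      simp only [MaxTensor.map_ofAlg_tmul, hom_apply, map_one, StarAlgEquiv.one_apply]; rfl) x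

/-- The automorphism `α_g ⊗ β_g` of `A ⊗_max C`. -/
def tensorAut (α : CStarAction G A) (β : CStarAction G C) (g : G) :
    MaxTensor A C ≃⋆ₐ[ℂ] MaxTensor A C :=
  StarAlgEquiv.ofBijective (MaxTensor.map (α.hom g) (β.hom g)) (by
    refine Function.bijective_iff_has_inverse.2 ⟨MaxTensor.map (α.hom g⁻¹) (β.hom g⁻¹), ?_, ?_⟩
    · intro x; rw [← map_hom_mul, inv_mul_cancel, map_hom_one]
    · intro x; rw [← map_hom_mul, mul_inv_cancel, map_hom_one])

theorem tensorAut_apply (α : CStarAction G A) (β : CStarAction G C) (g : G) (x : MaxTensor A C) :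
    tensorAut α β g x = MaxTensor.map (α.hom g) (β.hom g) x := rfl

theorem tensorAut_tmul (α : CStarAction G A) (β : CStarAction G C) (g : G) (a : A) (c : C) :
    tensorAut α β g (MaxTensor.ofAlg A C (a ⊗ₜ[ℂ] c)) =
      MaxTensor.ofAlg A C (α.aut g a ⊗ₜ[ℂ] β.aut g c) := MaxTensor.map_ofAlg_tmul _ _ _ _

theorem continuous_tensorAut (α : CStarAction G A) (β : CStarAction G C) (x : MaxTensor A C) :
    Continuous fun g => tensorAut α β g x := by
  have hlip : ∀ g (x y : MaxTensor A C),
      dist (tensorAut α β g x) (tensorAut α β g y) ≤ dist x y := fun g x y => by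
    rw [dist_eq_norm, dist_eq_norm, ← map_sub]
    exact NonUnitalStarAlgHom.norm_apply_le (MaxTensor.map (α.hom g) (β.hom g)) (x - y)
  have halg : ∀ y : A ⊗[ℂ] C, Continuous fun g => tensorAut α β g (MaxTensor.ofAlg A C y) := by
    intro y
    induction y using TensorProduct.induction_on with
    | zero => simpa using continuous_const
    | tmul a c =>
      have h0 : ∀ g, tensorAut α β g (MaxTensor.ofAlg A C (a ⊗ₜ[ℂ] c)) =
          MaxTensor.inl A C (α.aut g a) * MaxTensor.inr A C (β.aut g c) := fun g => by
        rw [tensorAut_tmul, MaxTensor.ofAlg_tmul]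
      simp only [h0]
      have h1 : Continuous (MaxTensor.inl A C) :=
        AddMonoidHomClass.continuous_of_bound _ 1 fun x => by
          simpa using NonUnitalStarAlgHom.norm_apply_le (MaxTensor.inl A C) x
      have h2 : Continuous (MaxTensor.inr A C) :=
        AddMonoidHomClass.continuous_of_bound _ 1 fun x => by
          simpa using NonUnitalStarAlgHom.norm_apply_le (MaxTensor.inr A C) x
      exact (h1.comp (α.continuous_apply a)).mul (h2.comp (β.continuous_apply c))
    | add x y hx hy => simp only [map_add]; exact hx.add hy
  rw [continuous_iff_continuousAt]
  intro g₀
  rw [ContinuousAt, Metric.tendsto_nhds]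
  intro ε hε
  obtain ⟨y, hy⟩ := MaxTensor.denseRange_ofAlg.exists_dist_lt x (show 0 < ε / 3 by positivity)
  have h := Metric.tendsto_nhds.1 ((halg y).tendsto g₀) (ε / 3) (by positivity)
  filter_upwards [h] with g hg
  have h1 := hlip g x (MaxTensor.ofAlg A C y)
  have h2 := hlip g₀ (MaxTensor.ofAlg A C y) x
  rw [dist_comm _ x] at h2
  have h3 := dist_triangle4 (tensorAut α β g x) (tensorAut α β g (MaxTensor.ofAlg A C y))
    (tensorAut α β g₀ (MaxTensor.ofAlg A C y)) (tensorAut α β g₀ x)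
  linarith

/-- The diagonal action `α ⊗ β` on `A ⊗_max C`, with `(α ⊗ β)_g (a ⊗ c) = α_g(a) ⊗ β_g(c)`. -/
def tensor (α : CStarAction G A) (β : CStarAction G C) : CStarAction G (MaxTensor A C) where
  aut :=
    { toFun := tensorAut α β
      map_one' := StarAlgEquiv.ext fun x => map_hom_one α β x
      map_mul' := fun g h => StarAlgEquiv.ext fun x => map_hom_mul α β g h x }
  continuous_apply := continuous_tensorAut α β

end CStarAction

/-- Cuntz subequivalence `a ≲ b`: there is a sequence `x_n` with `‖x_n b x_n^* - a‖ → 0`.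
It is used for positive `b`; then `a`, a limit of positive elements, is positive too. -/
def CuntzSubeq {A : Type*} [CStarAlgebra A] (a b : A) : Prop :=
  ∃ x : ℕ → A, Tendsto (fun n => ‖x n * b * star (x n) - a‖) atTop (𝓝 0)

/-- A completely positive map has order zero if it preserves orthogonality of positive elements. -/
def IsOrderZero {A B : Type*} [CStarAlgebra A] [PartialOrder A] [StarOrderedRing A]
    [CStarAlgebra B] [PartialOrder B] [StarOrderedRing B] (φ : A →CP B) : Prop :=
  ∀ a b : A, 0 ≤ a → 0 ≤ b → a * b = 0 → b * a = 0 → φ a * φ b = 0 ∧ φ b * φ a = 0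

/-- A `*`-homomorphism `φ : A → B` is tracially sequentially-split by order zero. -/
def IsTraciallySeqSplit (ω : Ultrafilter ℕ) {A B : Type*} [CStarAlgebra A]
    [CStarAlgebra B] [PartialOrder B] [StarOrderedRing B] (φ : A →⋆ₐ[ℂ] B) : Prop :=
  ∀ z : CStarUltrapower ω A, 0 ≤ z → z ≠ 0 →
    ∃ (ψ : B →CP CStarUltrapower ω A) (g : CStarUltrapower ω A),
      IsOrderZero ψ ∧
      g ∈ CStarUltrapower.central ω A ∧ 0 ≤ g ∧ g ≠ 0 ∧
      (∀ a : A, ψ (φ a) = CStarUltrapower.const ω A a * g) ∧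
      CuntzSubeq (1 - g) z

/-- An equivariant `*`-homomorphism `φ : (A, α) → (B, β)` is `G`-tracially sequentially-split by
order zero. -/
def IsEquivTraciallySeqSplit (ω : Ultrafilter ℕ) {G A B : Type*} [Group G] [TopologicalSpace G]
    [CStarAlgebra A] [CStarAlgebra B] [PartialOrder B] [StarOrderedRing B]
    (α : CStarAction G A) (β : CStarAction G B) (φ : A →⋆ₐ[ℂ] B) : Prop :=
  (∀ s a, φ (α.aut s a) = β.aut s (φ a)) ∧
  ∀ x : CStarUltrapower ω A, 0 ≤ x → x ≠ 0 →
    ∃ (ψ : B →CP CStarUltrapower ω A) (g : CStarUltrapower ω A),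
      IsOrderZero ψ ∧
      (∀ s b, ψ (β.aut s b) = CStarUltrapower.map ω (α.hom s) (ψ b)) ∧
      g ∈ CStarUltrapower.central ω A ∧ 0 ≤ g ∧
      (∀ a : A, ψ (φ a) = g * CStarUltrapower.const ω A a ∧
        ψ (φ a) = CStarUltrapower.const ω A a * g) ∧
      CuntzSubeq (1 - g) x

end

/-! Everything rests on a structure theorem: an order zero map `φ` on a unital algebra satisfies `φ
x * φ y = φ 1 * φ (x * y)`, so morally `φ = h π` with `h = φ 1` and `π` a `*`-homomorphism commuting
with `h` (`IsOrderZero.isWeightedHom`). Conversely, such weighted homomorphisms are completely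
positive of order zero. The homomorphism `π` is never constructed; the elements `(h + ε)⁻¹ φ x`
stand in for `π x`.

The structure theorem comes from two facts. A bounded bilinear map killing orthogonal positive pairs
satisfies a quadratic identity (`diagDefect_eq_zero`); with this identity, a certain vector is
isotropic for the image of a 3 × 3 Gram matrix, hence lies in its kernel, and the rows of that
kernel equation are the multiplicative relations.

Given `φ : C → A_ω ∩ A'`, the map `a ⊗ c ↦ a φ(c)` is a weighted homomorphism `ψ` on the algebraic
tensor product. The supremum over `ε` of `‖(h + ε)⁻¹ ψ x‖` is a C*-seminorm, so the maximal one
dominates it; thus `‖ψ x‖ ≤ ‖h‖ ‖x‖_max` and `ψ` extends to the completion. Equivariance passes over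
by density of the algebraic tensors.

Conversely, restrict `ψ` to `1 ⊗ C`. Since `a ⊗ 1` and `1 ⊗ c` commute, `g` annihilates the
commutator of `a` and `ψ (1 ⊗ c)`, and weighted multiplicativity upgrades this to the commutator
being zero. In both directions `φ 1 = g`, so the Cuntz conditions coincide. -/

/-! ### Bilinear maps vanishing on orthogonal positive pairs -/

section Orthogonality

variable {A D : Type*} [CStarAlgebra A]

variable [NormedAddCommGroup D] [NormedSpace ℂ D]

/-- The defect of a bilinear map `B` from satisfying `2 B(x, x) = B(1, x²) + B(x², 1)`. -/
noncomputable def diagDefect (B : A →ₗ[ℂ] A →ₗ[ℂ] D) (x : A) : D :=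
  B 1 (x * x) + B (x * x) 1 - (2 : ℂ) • B x x

/-- The terms linear and quadratic in `t` cancel. This freedom to recentre `x` drives the halving
argument of `diagDefect_eq_zero`. -/
theorem diagDefect_sub_algebraMap (B : A →ₗ[ℂ] A →ₗ[ℂ] D) (x : A) (t : ℝ) :
    diagDefect B (x - algebraMap ℝ A t) = diagDefect B x := by
  have h : algebraMap ℝ A t = (t : ℂ) • (1 : A) := by
    rw [Algebra.algebraMap_eq_smul_one, Complex.coe_smul]
  simp only [diagDefect, h, sub_mul, mul_sub, map_sub, map_smul, LinearMap.sub_apply,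
    LinearMap.smul_apply, smul_mul_assoc, mul_smul_comm, one_mul, mul_one]
  module

theorem diagDefect_sub_of_orthogonal {B : A →ₗ[ℂ] A →ₗ[ℂ] D} {y z : A} (hyz : y * z = 0)
    (hzy : z * y = 0) (h1 : B y z = 0) (h2 : B z y = 0) :
    diagDefect B (y - z) = diagDefect B y + diagDefect B z := by
  simp only [diagDefect, sub_mul, mul_sub, map_sub, LinearMap.sub_apply, h1, h2, hyz, hzy,
    LinearMap.zero_apply, map_zero]
  module

variable [PartialOrder A] [StarOrderedRing A]

theorem norm_sub_half_le_half_of_nonneg [Nontrivial A] {p : A} (hp : 0 ≤ p) {r : ℝ} (hr : ‖p‖ ≤ r) :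
    ‖p - algebraMap ℝ A (r / 2)‖ ≤ r / 2 := by
  have hr0 : 0 ≤ r := (norm_nonneg p).trans hr
  have hsa : IsSelfAdjoint p := .of_nonneg hp
  have h : p - algebraMap ℝ A (r / 2) = cfc (fun t : ℝ => t - r / 2) p := by
    rw [cfc_sub (fun t : ℝ => t) (fun _ => r / 2) p, cfc_id' ℝ p, cfc_const (r / 2) p]
  rw [h]
  refine norm_cfc_le (by positivity) fun t ht => ?_
  have h0 : 0 ≤ t := spectrum_nonneg_of_nonneg hp ht
  have h1 : t ≤ r := (Real.le_norm_self t).trans ((spectrum.norm_le_norm_of_mem ht).trans hr)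
  rw [Real.norm_eq_abs, abs_le]
  constructor <;> linarith

theorem mul_sqrt_eq_zero {y z : A} (hz : 0 ≤ z) (h : y * z = 0) : y * CFC.sqrt z = 0 := by
  rw [← CStarRing.mul_star_self_eq_zero_iff, star_mul,
    (IsSelfAdjoint.of_nonneg (CFC.sqrt_nonneg z)).star_eq, mul_assoc y, ← mul_assoc _ _ (star y),
    CFC.sqrt_mul_sqrt_self z, ← mul_assoc, h, zero_mul]

theorem sqrt_mul_eq_zero {y z : A} (hz : 0 ≤ z) (h : z * y = 0) : CFC.sqrt z * y = 0 := by
  rw [← CStarRing.star_mul_self_eq_zero_iff, star_mul,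
    (IsSelfAdjoint.of_nonneg (CFC.sqrt_nonneg z)).star_eq, mul_assoc, ← mul_assoc _ _ y,
    CFC.sqrt_mul_sqrt_self z, h, mul_zero]

/-- A bounded bilinear map that vanishes on pairs of orthogonal positive elements satisfies
`2 B(x, x) = B(1, x²) + B(x², 1)` for self-adjoint `x`. -/
theorem diagDefect_eq_zero {B : A →ₗ[ℂ] A →ₗ[ℂ] D} {K : ℝ}
    (hK : ∀ x y, ‖B x y‖ ≤ K * ‖x‖ * ‖y‖)
    (hB : ∀ y z : A, 0 ≤ y → 0 ≤ z → y * z = 0 → z * y = 0 → B y z = 0)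
    {x : A} (hx : IsSelfAdjoint x) : diagDefect B x = 0 := by
  cases subsingleton_or_nontrivial A
  · rw [Subsingleton.elim x 0]; simp [diagDefect]
  have hK0 : 0 ≤ K := by
    have := (norm_nonneg _).trans (hK 1 1)
    simpa using this
  have hbound : ∀ x : A, ‖diagDefect B x‖ ≤ 4 * K * ‖x‖ ^ 2 := fun x => by
    have h0 : ‖x * x‖ ≤ ‖x‖ * ‖x‖ := norm_mul_le x x
    have h1 : ‖B 1 (x * x)‖ ≤ K * ‖x‖ ^ 2 := (hK _ _).trans (by
      rw [norm_one, mul_one, sq]; gcongr)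
    have h2 : ‖B (x * x) 1‖ ≤ K * ‖x‖ ^ 2 := (hK _ _).trans (by
      rw [norm_one, mul_one, sq]; gcongr)
    have h3 : ‖(2 : ℂ) • B x x‖ ≤ 2 * (K * ‖x‖ ^ 2) := by
      rw [norm_smul, Complex.norm_ofNat]
      exact mul_le_mul_of_nonneg_left ((hK x x).trans (by rw [sq, mul_assoc])) two_pos.le
    calc ‖diagDefect B x‖ ≤ ‖B 1 (x * x)‖ + ‖B (x * x) 1‖ + ‖(2 : ℂ) • B x x‖ :=
          (norm_sub_le _ _).trans (add_le_add_left (norm_add_le _ _) _)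
      _ ≤ 4 * K * ‖x‖ ^ 2 := by linarith
  -- Split `x` into its positive and negative parts and recentre each at `r / 2`. The radius halves,
  -- so the quadratic bound drops by a factor 4, while there are two summands: each round gains a
  -- factor 2.
  have key : ∀ (n : ℕ) (r : ℝ) (x : A), IsSelfAdjoint x → ‖x‖ ≤ r →
      ‖diagDefect B x‖ ≤ 4 * K * r ^ 2 / 2 ^ n := by
    intro n
    induction n with
    | zero =>
      intro r x _ hr
      refine (hbound x).trans ?_
      rw [pow_zero, div_one]
      gcongr
    | succ n ih =>
      intro r x hx hr
      have hhalf : ∀ p : A, 0 ≤ p → ‖p‖ ≤ r →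
          ‖diagDefect B p‖ ≤ 4 * K * (r / 2) ^ 2 / 2 ^ n := fun p hp hpr => by
        rw [← diagDefect_sub_algebraMap B p (r / 2)]
        exact ih _ _ ((IsSelfAdjoint.of_nonneg hp).sub (.algebraMap A (.all _)))
          (norm_sub_half_le_half_of_nonneg hp hpr)
      have hp := CFC.posPart_nonneg x
      have hn := CFC.negPart_nonneg x
      have hpn := CFC.posPart_mul_negPart x
      have hnp := CFC.negPart_mul_posPart x
      rw [← CFC.posPart_sub_negPart x hx, diagDefect_sub_of_orthogonal hpn hnp
        (hB _ _ hp hn hpn hnp) (hB _ _ hn hp hnp hpn)]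
      calc _ ≤ _ := norm_add_le _ _
        _ ≤ 4 * K * (r / 2) ^ 2 / 2 ^ n + 4 * K * (r / 2) ^ 2 / 2 ^ n := add_le_add
            (hhalf _ hp ((CStarAlgebra.norm_posPart_le x).trans hr))
            (hhalf _ hn ((CStarAlgebra.norm_negPart_le x).trans hr))
        _ = _ := by rw [pow_succ]; ring
  have hlim : Tendsto (fun n : ℕ => 4 * K * ‖x‖ ^ 2 / 2 ^ n) atTop (𝓝 0) :=
    tendsto_const_nhds.div_atTop (tendsto_pow_atTop_atTop_of_one_lt one_lt_two)
  exact norm_le_zero_iff.1 (ge_of_tendsto' hlim fun n => key n _ x hx le_rfl)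

end Orthogonality

/-! ### Weighted homomorphisms -/

/-- A linear map `ψ` from a unital `*`-algebra to a `C*`-algebra that is a `*`-homomorphism up to
the positive weight `ψ 1`: it preserves adjoints and `ψ x * ψ y = ψ 1 * ψ (x * y)`. -/
structure IsWeightedHom {E D : Type*} [Ring E] [StarRing E] [Algebra ℂ E] [CStarAlgebra D]
    [PartialOrder D] (ψ : E →ₗ[ℂ] D) : Prop where
  one_nonneg : 0 ≤ ψ 1
  map_star : ∀ x, ψ (star x) = star (ψ x)
  map_mul_map : ∀ x y, ψ x * ψ y = ψ 1 * ψ (x * y)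

/-! ### Gram matrices and isotropic vectors -/

section CStarMatrix

variable {A : Type*} [CStarAlgebra A] [PartialOrder A] [StarOrderedRing A]

/-- The Gram matrix `(c_i^* c_j)` of a family in a `C*`-algebra. -/
def CStarMatrix.gram {ι : Type*} (c : ι → A) : CStarMatrix ι ι A := fun i j => star (c i) * c j

omit [PartialOrder A] [StarOrderedRing A] in
theorem CStarMatrix.gram_apply {ι : Type*} (c : ι → A) (i j : ι) :
    CStarMatrix.gram c i j = star (c i) * c j := rfl

theorem CStarMatrix.gram_nonneg {k : ℕ} (c : Fin (k + 1) → A) : 0 ≤ CStarMatrix.gram c := by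
  -- A square matrix with top row `c` and zeros below; the successor in `Fin (k + 1)` guarantees
  -- that there is a top row.
  let N : CStarMatrix (Fin (k + 1)) (Fin (k + 1)) A := fun i j => if i = 0 then c j else 0
  have hN : ∀ i j, N i j = if i = 0 then c j else 0 := fun _ _ => rfl
  have h : CStarMatrix.gram c = star N * N := by
    ext i j
    simp only [CStarMatrix.mul_apply, CStarMatrix.star_apply, hN, CStarMatrix.gram_apply]
    simp
  rw [h]
  exact star_mul_self_nonneg N

theorem exists_eq_star_mul_self_of_nonneg {B : Type*} [NonUnitalCStarAlgebra B] [PartialOrder B]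
    [StarOrderedRing B] {b : B} (hb : 0 ≤ b) : ∃ c, b = star c * c :=
  CStarAlgebra.nonneg_iff_eq_star_mul_self.1 hb

/-- An isotropic vector of a positive matrix lies in its kernel. -/
theorem CStarMatrix.sum_mul_eq_zero_of_isotropic {ι : Type*} [Fintype ι] {M : CStarMatrix ι ι A}
    (hM : 0 ≤ M) {v : ι → A} (hv : ∑ i, ∑ j, star (v i) * M i j * v j = 0) (i : ι) :
    ∑ j, M i j * v j = 0 := by
  -- With `M = N* N`, the form at `v` is a sum of positive terms `(N v)_l* (N v)_l`, so isotropy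
  -- forces `N v = 0`.
  obtain ⟨N, rfl⟩ := exists_eq_star_mul_self_of_nonneg hM
  have h0 : ∀ i, ∑ j, (star N * N) i j * v j = ∑ l, star (N l i) * ∑ j, N l j * v j := fun i => by
    simp only [CStarMatrix.mul_apply, CStarMatrix.star_apply, Finset.sum_mul, Finset.mul_sum,
      mul_assoc]
    exact Finset.sum_comm
  have h1 : ∑ i, ∑ j, star (v i) * (star N * N) i j * v j =
      ∑ l, star (∑ j, N l j * v j) * ∑ j, N l j * v j := by
    simp only [mul_assoc]
    simp only [← Finset.mul_sum, h0]
    simp only [star_sum, star_mul, Finset.sum_mul]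
    simp only [Finset.mul_sum, ← mul_assoc]
    rw [Finset.sum_comm]
  rw [h1, Finset.sum_eq_zero_iff_of_nonneg fun l _ => star_mul_self_nonneg _] at hv
  rw [h0]
  refine Finset.sum_eq_zero fun l _ => ?_
  rw [CStarRing.star_mul_self_eq_zero_iff _ |>.1 (hv l (Finset.mem_univ l)), mul_zero]

end CStarMatrix

/-! ### The structure theorem for order zero maps -/

section OrderZero

variable {A D : Type*} [CStarAlgebra A] [PartialOrder A] [StarOrderedRing A]
  [CStarAlgebra D] [PartialOrder D] [StarOrderedRing D]

theorem CompletelyPositiveMap.gram_nonneg (φ : A →CP D) {k : ℕ} (c : Fin (k + 1) → A) :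
    0 ≤ (CStarMatrix.gram c).map φ :=
  φ.map_cstarMatrix_nonneg _ (CStarMatrix.gram_nonneg c)

/-- Compare the off-diagonal entries of the image of the Gram matrix of `(1, x)`, which is positive
and hence self-adjoint. -/
theorem CompletelyPositiveMap.map_star (φ : A →CP D) (x : A) : φ (star x) = star (φ x) := by
  have h := CStarMatrix.star_apply_of_isSelfAdjoint
    (IsSelfAdjoint.of_nonneg (φ.gram_nonneg ![1, x])) (i := 0) (j := 1)
  simpa [CStarMatrix.gram_apply] using h.symm

namespace IsOrderZero

variable {φ : A →CP D}

theorem exists_bound (φ : A →CP D) : ∃ K : ℝ, 0 ≤ K ∧ ∀ x, ‖φ x‖ ≤ K * ‖x‖ := by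
  obtain ⟨K, hK⟩ := PositiveLinearMap.exists_norm_apply_le (PositiveLinearMap.ofClass φ)
  exact ⟨K, K.2, hK⟩

/-- The bilinear map `(x, y) ↦ φ(x) d φ(y)`. -/
noncomputable def sandwich (φ : A →CP D) (d : D) : A →ₗ[ℂ] A →ₗ[ℂ] D :=
  (LinearMap.mul ℂ D).compl₁₂ ((LinearMap.mulRight ℂ d).comp φ.toLinearMap) φ.toLinearMap

theorem sandwich_apply (d : D) (x y : A) : sandwich φ d x y = φ x * d * φ y := rfl

/-- The quadratic identity for `φ(x) d φ(y)`. It is needed for `d = 1`, where its hypothesis is the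
order zero condition, and for `d = φ 1`. -/
theorem sandwich_self_add_self {d : D}
    (hd : ∀ y z : A, 0 ≤ y → 0 ≤ z → y * z = 0 → z * y = 0 → φ y * d * φ z = 0)
    {x : A} (hx : IsSelfAdjoint x) :
    φ x * d * φ x + φ x * d * φ x = φ 1 * d * φ (x * x) + φ (x * x) * d * φ 1 := by
  obtain ⟨K, hK0, hK⟩ := exists_bound φ
  have hbound : ∀ x y, ‖sandwich φ d x y‖ ≤ K * ‖d‖ * K * ‖x‖ * ‖y‖ := fun x y => by
    rw [sandwich_apply]
    calc ‖φ x * d * φ y‖ ≤ ‖φ x‖ * ‖d‖ * ‖φ y‖ := norm_mul₃_le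
      _ ≤ (K * ‖x‖) * ‖d‖ * (K * ‖y‖) := by gcongr <;> apply hK
      _ = _ := by ring
  have h := diagDefect_eq_zero hbound hd hx
  rw [diagDefect, sub_eq_zero, two_smul] at h
  exact h.symm

variable (hφ : IsOrderZero φ)

include hφ

theorem map_mul_self_add_self {x : A} (hx : IsSelfAdjoint x) :
    φ x * φ x + φ x * φ x = φ 1 * φ (x * x) + φ (x * x) * φ 1 := by
  simpa using sandwich_self_add_self (φ := φ) (d := 1)
    (fun y z hy hz h1 h2 => by simpa using (hφ y z hy hz h1 h2).1) hx

/-- Multiply the case `d = 1` of the quadratic identity, taken at `√z`, by `φ y` on the left: as `y`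
is orthogonal to `z` and `√z`, only this product survives. -/
theorem map_mul_map_one_mul_map {y z : A} (hy : 0 ≤ y) (hz : 0 ≤ z) (hyz : y * z = 0)
    (hzy : z * y = 0) : φ y * φ 1 * φ z = 0 := by
  have hw := CFC.sqrt_nonneg z
  have h := hφ.map_mul_self_add_self (IsSelfAdjoint.of_nonneg hw)
  rw [CFC.sqrt_mul_sqrt_self z] at h
  have h1 := (hφ y z hy hz hyz hzy).1
  have h2 := (hφ y _ hy hw (mul_sqrt_eq_zero hz hyz) (sqrt_mul_eq_zero hz hzy)).1
  have h3 := congrArg (φ y * ·) h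
  simpa only [mul_add, ← mul_assoc, h1, h2, zero_mul, add_zero] using h3.symm

theorem map_mul_map_of_isSelfAdjoint {x : A} (hx : IsSelfAdjoint x) (y : A) :
    φ x * φ 1 = φ 1 * φ x ∧ φ y * φ x = φ (y * x) * φ 1 := by
  have h1 := hφ.map_mul_self_add_self hx
  have h2 := sandwich_self_add_self (φ := φ) (d := φ 1)
    (fun y z hy hz => hφ.map_mul_map_one_mul_map hy hz) hx
  have hsa : star (φ x) = φ x := by rw [← φ.map_star, hx.star_eq]
  have hsa1 : star (φ 1) = φ 1 := by rw [← φ.map_star, star_one]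
  -- This is the quadratic form of the next matrix at `(-φ x, φ 1, 0)`. The identities `h1` and `h2`
  -- evaluate only twice its terms, hence the doubling.
  have h0 : φ x * φ 1 * φ x - φ x * φ x * φ 1 - φ 1 * φ x * φ x + φ 1 * φ (x * x) * φ 1 = 0 := by
    refine (smul_eq_zero_iff_right (two_ne_zero (α := ℂ))).1 ?_
    rw [two_smul]
    calc _ = (φ x * φ 1 * φ x + φ x * φ 1 * φ x) - (φ x * φ x + φ x * φ x) * φ 1
          - φ 1 * (φ x * φ x + φ x * φ x) + (φ 1 * φ (x * x) * φ 1 + φ 1 * φ (x * x) * φ 1) := by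
          noncomm_ring
      _ = 0 := by rw [h1, h2]; noncomm_ring
  have hM : 0 ≤ (CStarMatrix.gram ![1, x, star y]).map φ := φ.gram_nonneg (k := 2) _
  -- If `φ = h π`, the vector `(-φ x, h, 0)` must be in the kernel. Its last entry is zero, so
  -- isotropy does not involve `y`; yet the last row of the kernel equation gives the product
  -- formula for `y`, and the first gives commutation with `φ 1`.
  have hker := CStarMatrix.sum_mul_eq_zero_of_isotropic hM (v := ![-φ x, φ 1, 0]) (by
      simp only [Fin.sum_univ_three, CStarMatrix.map_apply, CStarMatrix.gram_apply, Matrix.cons_val, star_neg,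
        star_zero, hsa, hsa1, hx.star_eq, star_one, one_mul, mul_one]
      refine Eq.trans ?_ h0
      noncomm_ring)
  have hk0 := hker 0
  have hk2 := hker 2
  simp only [Fin.sum_univ_three, CStarMatrix.map_apply, CStarMatrix.gram_apply, Matrix.cons_val, star_one, star_star,
    one_mul, mul_one, mul_zero, add_zero, mul_neg] at hk0 hk2
  exact ⟨(neg_add_eq_zero.1 hk0).symm, neg_add_eq_zero.1 hk2⟩

theorem isWeightedHom : IsWeightedHom φ.toLinearMap where
  one_nonneg := map_nonneg φ zero_le_one
  map_star := φ.map_star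
  map_mul_map := by
    have hcomm : ∀ x : A, φ x * φ 1 = φ 1 * φ x := fun x => by
      rw [← realPart_add_I_smul_imaginaryPart x]
      simp only [map_add, map_smul, add_mul, mul_add, smul_mul_assoc, mul_smul_comm,
        (hφ.map_mul_map_of_isSelfAdjoint (realPart x).2 1).1,
        (hφ.map_mul_map_of_isSelfAdjoint (imaginaryPart x).2 1).1]
    intro y x
    change φ y * φ x = φ 1 * φ (y * x)
    rw [← hcomm, ← realPart_add_I_smul_imaginaryPart x]
    simp only [map_add, map_smul, add_mul, mul_add, smul_mul_assoc, mul_smul_comm,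
      (hφ.map_mul_map_of_isSelfAdjoint (realPart x).2 y).2,
      (hφ.map_mul_map_of_isSelfAdjoint (imaginaryPart x).2 y).2]

end IsOrderZero

end OrderZero

/-! ### Resolvents of positive elements -/

section Resolvent

variable {D : Type*} [CStarAlgebra D] [PartialOrder D] [StarOrderedRing D]

/-- The resolvent `(h + ε)⁻¹` of a positive element. -/
noncomputable def posResolvent (h : D) (ε : ℝ) : D := cfc (fun t : ℝ => (t + ε)⁻¹) h

namespace posResolvent

variable {h : D} {ε : ℝ}

theorem continuousOn (hh : 0 ≤ h) (hε : 0 < ε) :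
    ContinuousOn (fun t : ℝ => (t + ε)⁻¹) (spectrum ℝ h) :=
  ContinuousOn.inv₀ (by fun_prop) fun t ht => by
    have := spectrum_nonneg_of_nonneg hh ht
    positivity

omit [PartialOrder D] [StarOrderedRing D] in
theorem isSelfAdjoint : IsSelfAdjoint (posResolvent h ε) := cfc_predicate _ _

omit [PartialOrder D] [StarOrderedRing D] in
theorem commute {b : D} (hb : Commute h b) : Commute (posResolvent h ε) b := hb.cfc_real _

theorem mul_add_algebraMap (hh : 0 ≤ h) (hε : 0 < ε) :
    posResolvent h ε * (h + algebraMap ℝ D ε) = 1 := by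
  have h1 : h + algebraMap ℝ D ε = cfc (fun t : ℝ => t + ε) h := by
    rw [cfc_add h (fun t : ℝ => t) (fun _ => ε), cfc_id' ℝ h, cfc_const ε h]
  rw [h1, posResolvent, ← cfc_mul _ _ h (continuousOn hh hε) (by fun_prop), ← cfc_one ℝ h]
  refine cfc_congr fun t ht => ?_
  have := spectrum_nonneg_of_nonneg hh ht
  exact inv_mul_cancel₀ (by positivity)

/-- The positive square root of the resolvent. -/
theorem exists_sqrt (hh : 0 ≤ h) (hε : 0 < ε) :
    ∃ s : D, IsSelfAdjoint s ∧ s * s = posResolvent h ε ∧ ∀ b, Commute h b → Commute s b := by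
  refine ⟨cfc (fun t : ℝ => √((t + ε)⁻¹)) h, cfc_predicate _ _, ?_, fun b hb => hb.cfc_real _⟩
  have hc : ContinuousOn (fun t : ℝ => √((t + ε)⁻¹)) (spectrum ℝ h) :=
    Real.continuous_sqrt.comp_continuousOn (continuousOn hh hε)
  rw [← cfc_mul _ _ h hc hc]
  refine cfc_congr fun t ht => ?_
  have := spectrum_nonneg_of_nonneg hh ht
  exact Real.mul_self_sqrt (by positivity)

theorem norm_mul_self_le (hh : 0 ≤ h) (hε : 0 < ε) : ‖posResolvent h ε * h‖ ≤ 1 := by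
  have hc := continuousOn hh hε
  have h1 : posResolvent h ε * h = cfc (fun t : ℝ => (t + ε)⁻¹ * t) h := by
    rw [cfc_mul _ (fun t : ℝ => t) h hc (by fun_prop), cfc_id' ℝ h, posResolvent]
  rw [h1]
  refine norm_cfc_le zero_le_one fun t ht => ?_
  have := spectrum_nonneg_of_nonneg hh ht
  rw [Real.norm_of_nonneg (by positivity), inv_mul_le_one₀ (by positivity)]
  linarith

/-- On the spectrum, `ε t ≤ (t + ε)²`. This is the decay needed for `tendsto_posResolvent_mul`. -/
theorem norm_smul_mul_mul_self_le (hh : 0 ≤ h) (hε : 0 < ε) :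
    ‖ε • (posResolvent h ε * posResolvent h ε * h)‖ ≤ 1 := by
  have hc := continuousOn hh hε
  have h1 : ε • (posResolvent h ε * posResolvent h ε * h) =
      cfc (fun t : ℝ => ε • ((t + ε)⁻¹ * (t + ε)⁻¹ * t)) h := by
    rw [cfc_smul ε (fun t : ℝ => (t + ε)⁻¹ * (t + ε)⁻¹ * t) h ((hc.mul hc).mul (by fun_prop)),
      cfc_mul (fun t : ℝ => (t + ε)⁻¹ * (t + ε)⁻¹) (fun t : ℝ => t) h (hc.mul hc) (by fun_prop),
      cfc_mul _ _ h hc hc, cfc_id' ℝ h, posResolvent]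
  rw [h1]
  refine norm_cfc_le zero_le_one fun t ht => ?_
  have := spectrum_nonneg_of_nonneg hh ht
  rw [smul_eq_mul, Real.norm_of_nonneg (by positivity), ← mul_inv, ← mul_assoc, mul_right_comm,
    mul_inv_le_iff₀ (by positivity)]
  nlinarith

end posResolvent

end Resolvent

/-! ### The C*-seminorm of a weighted homomorphism -/

namespace IsWeightedHom

variable {E D : Type*} [Ring E] [StarRing E] [Algebra ℂ E] [CStarAlgebra D]
    [PartialOrder D] [StarOrderedRing D] {ψ : E →ₗ[ℂ] D} (hψ : IsWeightedHom ψ)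

include hψ

omit [StarOrderedRing D] in
theorem commute_one (x : E) : Commute (ψ 1) (ψ x) := by
  rw [commute_iff_eq, hψ.map_mul_map, hψ.map_mul_map x 1, one_mul, mul_one]

omit [StarOrderedRing D] in
theorem map_eq_zero_of_map_one_eq_zero (h : ψ 1 = 0) (x : E) : ψ x = 0 := by
  rw [← CStarRing.star_mul_self_eq_zero_iff, ← hψ.map_star, hψ.map_mul_map, h, zero_mul]

omit [StarOrderedRing D] in
theorem star_map_mul_map (x y : E) : star (ψ x) * ψ y = ψ 1 * ψ (star x * y) := by
  rw [← hψ.map_star, hψ.map_mul_map]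

/-- With `r` the resolvent and `h = ψ 1`, the error is `-ε r ψ x`. Since `(r ψ x)* (r ψ x) = r² h
ψ(x* x)` and `‖ε r² h‖ ≤ 1`, its squared norm is at most `ε ‖ψ (x* x)‖`. -/
theorem tendsto_posResolvent_mul (x : E) :
    Tendsto (fun ε => posResolvent (ψ 1) ε * ψ 1 * ψ x) (𝓝[>] (0 : ℝ)) (𝓝 (ψ x)) := by
  rw [tendsto_iff_norm_sub_tendsto_zero]
  have hlim : Tendsto (fun ε : ℝ => √(ε * ‖ψ (star x * x)‖)) (𝓝[>] (0 : ℝ)) (𝓝 0) := by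
    have : Continuous fun ε : ℝ => √(ε * ‖ψ (star x * x)‖) := by fun_prop
    simpa using (this.tendsto 0).mono_left nhdsWithin_le_nhds
  refine squeeze_zero' (.of_forall fun _ => norm_nonneg _) ?_ hlim
  filter_upwards [self_mem_nhdsWithin] with ε (hε : 0 < ε)
  have hh := hψ.one_nonneg
  set r := posResolvent (ψ 1) ε with hr
  have hsub : r * ψ 1 * ψ x - ψ x = -(ε • (r * ψ x)) := by
    have h1 := posResolvent.mul_add_algebraMap hh hε
    rw [← hr, mul_add, Algebra.algebraMap_eq_smul_one, mul_smul_comm, mul_one] at h1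
    have h2 := congrArg (· * ψ x) h1
    simp only [add_mul, one_mul, smul_mul_assoc] at h2
    rw [← eq_sub_iff_add_eq'] at h2
    rw [h2]
    abel
  have hsq : star (r * ψ x) * (r * ψ x) = r * r * ψ 1 * ψ (star x * x) := by
    have hc1 : Commute r (star (ψ x)) := by
      rw [← hψ.map_star]; exact posResolvent.commute (hψ.commute_one _)
    have hrs : star r = r := posResolvent.isSelfAdjoint.star_eq
    rw [star_mul, hrs, mul_assoc _ (ψ 1), ← hψ.star_map_mul_map, ← hc1.eq,
      mul_assoc r, ← mul_assoc _ r, ← hc1.eq]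
    simp only [mul_assoc]
  refine Real.le_sqrt_of_sq_le ?_
  rw [hsub, norm_neg, norm_smul, mul_pow, sq ‖r * ψ x‖, ← CStarRing.norm_star_mul_self, hsq,
    Real.norm_of_nonneg hε.le]
  have h3 := posResolvent.norm_smul_mul_mul_self_le hh hε
  rw [norm_smul, Real.norm_of_nonneg hε.le] at h3
  calc ε ^ 2 * ‖r * r * ψ 1 * ψ (star x * x)‖
      ≤ ε ^ 2 * (‖r * r * ψ 1‖ * ‖ψ (star x * x)‖) := by gcongr; exact norm_mul_le _ _
    _ = ε * (ε * ‖r * r * ψ 1‖) * ‖ψ (star x * x)‖ := by ring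
    _ ≤ ε * 1 * ‖ψ (star x * x)‖ := by gcongr
    _ = _ := by ring

omit [StarOrderedRing D] in
-- An approximate form of `π(x) π(y) = π(x y)`: as `δ → 0` the right side tends to `(h + ε)⁻¹ ψ(x
-- y)`. Separate parameters allow `δ` to vary with `ε` fixed.
theorem posResolvent_mul_map_mul (δ ε : ℝ) (x y : E) :
    posResolvent (ψ 1) δ * ψ x * (posResolvent (ψ 1) ε * ψ y) =
      posResolvent (ψ 1) ε * (posResolvent (ψ 1) δ * ψ 1 * ψ (x * y)) := by
  have h1 : Commute (posResolvent (ψ 1) ε) (ψ x) := posResolvent.commute (hψ.commute_one x)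
  have h2 : Commute (posResolvent (ψ 1) ε) (posResolvent (ψ 1) δ) :=
    posResolvent.commute (posResolvent.commute (Commute.refl _)).symm
  rw [mul_assoc, ← mul_assoc (ψ x), ← h1.eq, mul_assoc, hψ.map_mul_map, ← mul_assoc,
    ← h2.eq]
  simp only [mul_assoc]

omit [StarOrderedRing D] in
theorem star_posResolvent_mul_map (ε : ℝ) (x : E) :
    star (posResolvent (ψ 1) ε * ψ x) = posResolvent (ψ 1) ε * ψ (star x) := by
  rw [star_mul, posResolvent.isSelfAdjoint.star_eq, ← hψ.map_star,
    (posResolvent.commute (hψ.commute_one _)).eq]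

/-- The `C*`-seminorm `x ↦ sup_{ε > 0} ‖(ψ 1 + ε)⁻¹ ψ x‖` of a weighted homomorphism. -/
theorem exists_isCStarSeminorm
    (hbdd : ∀ x, ∃ M, ∀ ε, 0 < ε → ‖posResolvent (ψ 1) ε * ψ x‖ ≤ M) :
    ∃ p : Seminorm ℂ E, IsCStarSeminorm p ∧
      ∀ x ε, 0 < ε → ‖posResolvent (ψ 1) ε * ψ x‖ ≤ p x := by
  let q : E → ℝ := fun x => ⨆ ε : Set.Ioi (0 : ℝ), ‖posResolvent (ψ 1) ε * ψ x‖
  -- Boundedness matters here: a real supremum over an unbounded family takes the default value 0.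
  have hle : ∀ x ε, 0 < ε → ‖posResolvent (ψ 1) ε * ψ x‖ ≤ q x := fun x ε hε => by
    obtain ⟨M, hM⟩ := hbdd x
    exact le_ciSup (f := fun ε : Set.Ioi (0 : ℝ) => ‖posResolvent (ψ 1) ε * ψ x‖)
      ⟨M, by rintro _ ⟨ε, rfl⟩; exact hM ε ε.2⟩ ⟨ε, hε⟩
  have hq : ∀ x r, (∀ ε, 0 < ε → ‖posResolvent (ψ 1) ε * ψ x‖ ≤ r) → q x ≤ r :=
    fun x r hr => ciSup_le fun ε => hr ε ε.2
  have hq0 : ∀ x, 0 ≤ q x := fun x => (norm_nonneg _).trans (hle x 1 one_pos)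
  let p : Seminorm ℂ E := Seminorm.of q
    (fun x y => hq _ _ fun ε hε => by
      rw [map_add, mul_add]
      exact (norm_add_le _ _).trans (add_le_add (hle _ _ hε) (hle _ _ hε)))
    (fun c x => by
      simp only [q, map_smul, mul_smul_comm, norm_smul]
      rw [Real.mul_iSup_of_nonneg (norm_nonneg c)])
  have hmul : ∀ x y, q (x * y) ≤ q x * q y := fun x y => hq _ _ fun ε hε => by
    have hlim := ((hψ.tendsto_posResolvent_mul (x * y)).const_mul (posResolvent (ψ 1) ε)).norm
    refine le_of_tendsto hlim ?_
    filter_upwards [self_mem_nhdsWithin] with δ (hδ : 0 < δ)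
    rw [← hψ.posResolvent_mul_map_mul]
    exact (norm_mul_le _ _).trans (mul_le_mul (hle _ _ hδ) (hle _ _ hε) (norm_nonneg _) (hq0 _))
  -- Regroup `(r ψ x)* (r ψ x)` as `(r h) (r ψ(x* x))` and use `‖r h‖ ≤ 1`.
  have hsq : ∀ x, q x ≤ √(q (star x * x)) := fun x => hq _ _ fun ε hε => by
    refine Real.le_sqrt_of_sq_le ?_
    rw [sq, ← CStarRing.norm_star_mul_self, hψ.star_posResolvent_mul_map,
      hψ.posResolvent_mul_map_mul, ← mul_assoc,
      (posResolvent.commute (ε := ε)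
        ((posResolvent.commute (ε := ε) (Commute.refl (ψ 1))).symm.mul_right (Commute.refl _))).eq,
      mul_assoc]
    calc _ ≤ ‖posResolvent (ψ 1) ε * ψ 1‖ * ‖posResolvent (ψ 1) ε * ψ (star x * x)‖ :=
          norm_mul_le _ _
      _ ≤ 1 * q (star x * x) := mul_le_mul (posResolvent.norm_mul_self_le hψ.one_nonneg hε)
          (hle _ _ hε) (norm_nonneg _) zero_le_one
      _ = _ := one_mul _
  have hstar : ∀ x, q (star x) = q x := fun x => by
    simp only [q, ← hψ.star_posResolvent_mul_map, _root_.norm_star]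
  refine ⟨p, ⟨hmul, fun x => le_antisymm ?_ ?_⟩, hle⟩
  · exact (hmul _ _).trans_eq (by rw [hstar]; rfl)
  · calc q x * q x ≤ √(q (star x * x)) * √(q (star x * x)) :=
          mul_le_mul (hsq x) (hsq x) (hq0 _) (Real.sqrt_nonneg _)
      _ = _ := Real.mul_self_sqrt (hq0 _)

theorem norm_map_le {x : E} {M : ℝ}
    (hM : ∀ ε, 0 < ε → ‖posResolvent (ψ 1) ε * ψ x‖ ≤ M) : ‖ψ x‖ ≤ ‖ψ 1‖ * M := by
  refine le_of_tendsto (hψ.tendsto_posResolvent_mul x).norm ?_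
  filter_upwards [self_mem_nhdsWithin] with ε (hε : 0 < ε)
  rw [(posResolvent.commute (Commute.refl _)).eq, mul_assoc]
  exact (norm_mul_le _ _).trans (mul_le_mul_of_nonneg_left (hM ε hε) (norm_nonneg _))

/-- By the C*-identity the squared norm is `‖(r h)(r h)‖`, where `h = ψ 1` and `r` is its resolvent.
-/
theorem norm_posResolvent_mul_map_unitary_le {u : E} (hu : star u * u = 1) {ε : ℝ} (hε : 0 < ε) :
    ‖posResolvent (ψ 1) ε * ψ u‖ ≤ 1 := by
  rw [← abs_of_nonneg (norm_nonneg (posResolvent (ψ 1) ε * ψ u)), ← sq_le_one_iff_abs_le_one, sq,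
    ← CStarRing.norm_star_mul_self, hψ.star_posResolvent_mul_map, hψ.posResolvent_mul_map_mul, hu,
    mul_assoc _ (ψ 1), ← mul_assoc, (posResolvent.commute (hψ.commute_one 1)).mul_mul_mul_comm]
  have h := posResolvent.norm_mul_self_le hψ.one_nonneg hε
  exact (norm_mul_le _ _).trans (mul_le_one₀ h (norm_nonneg _) h)

end IsWeightedHom

/-! ### Complete positivity and lifting to the maximal tensor product -/

namespace IsWeightedHom

section CompletelyPositive

variable {B D : Type*} [CStarAlgebra B] [PartialOrder B] [StarOrderedRing B] [CStarAlgebra D]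
  [PartialOrder D] [StarOrderedRing D] {ψ : B →ₗ[ℂ] D} (hψ : IsWeightedHom ψ)

include hψ

/-- Approximate `ψ` by `r h ψ`. With `s = √r`, weighted multiplicativity turns `r h ψ(x* y)` into
`(s ψ x)* (s ψ y)`, so the approximants at `N* N` are of the form `X* X`. -/
theorem map_cstarMatrix_nonneg (k : ℕ) (M : CStarMatrix (Fin k) (Fin k) B) (hM : 0 ≤ M) :
    0 ≤ M.map ψ := by
  obtain ⟨N, rfl⟩ := exists_eq_star_mul_self_of_nonneg hM
  have hlim : Tendsto (fun ε => ((star N * N).map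
      fun x => posResolvent (ψ 1) ε * ψ 1 * ψ x : CStarMatrix (Fin k) (Fin k) D))
      (𝓝[>] (0 : ℝ)) (𝓝 ((star N * N).map ψ)) :=
    tendsto_pi_nhds.2 fun i => tendsto_pi_nhds.2 fun j => hψ.tendsto_posResolvent_mul _
  refine ge_of_tendsto hlim ?_
  filter_upwards [self_mem_nhdsWithin] with ε (hε : 0 < ε)
  obtain ⟨s, hs, hss, hcomm⟩ := posResolvent.exists_sqrt hψ.one_nonneg hε
  have h : ((star N * N).map fun x => posResolvent (ψ 1) ε * ψ 1 * ψ x :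
      CStarMatrix (Fin k) (Fin k) D) = star (N.map fun x => s * ψ x) * N.map fun x => s * ψ x := by
    ext i j
    simp only [CStarMatrix.mul_apply, CStarMatrix.star_apply, CStarMatrix.map_apply, map_sum,
      Finset.mul_sum]
    refine Finset.sum_congr rfl fun l _ => ?_
    have hc : Commute s (star (ψ (N l i))) := by
      rw [← hψ.map_star]; exact hcomm _ (hψ.commute_one _)
    rw [star_mul, hs.star_eq, mul_assoc _ (ψ 1), ← hψ.star_map_mul_map, ← hc.eq, ← hss,
      mul_assoc s, mul_assoc s, ← mul_assoc s (star _), ← mul_assoc (star _) s, hc.eq]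
  rw [h]
  exact star_mul_self_nonneg _

/-- A weighted homomorphism as a completely positive map. -/
noncomputable def toCompletelyPositiveMap : B →CP D where
  __ := ψ
  map_cstarMatrix_nonneg' := hψ.map_cstarMatrix_nonneg

theorem isOrderZero : IsOrderZero hψ.toCompletelyPositiveMap := fun a b _ _ hab hba =>
  ⟨(hψ.map_mul_map a b).trans (by rw [hab, map_zero, mul_zero]),
    (hψ.map_mul_map b a).trans (by rw [hba, map_zero, mul_zero])⟩

end CompletelyPositive

section Unitary

variable {C D : Type*} [CStarAlgebra C] [CStarAlgebra D] [PartialOrder D] [StarOrderedRing D]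
  {φ : C →ₗ[ℂ] D}

/-- A combination of four unitaries reduces this to the unitary bound, which is uniform in `ε`. -/
theorem exists_norm_posResolvent_mul_map_le (hφ : IsWeightedHom φ) (c : C) :
    ∃ M, ∀ ε, 0 < ε → ‖posResolvent (φ 1) ε * φ c‖ ≤ M := by
  obtain ⟨u, k, hc, -⟩ := CStarAlgebra.exists_sum_four_unitary c
  refine ⟨∑ i, ‖k i‖, fun ε hε => ?_⟩
  rw [hc, map_sum, Finset.mul_sum]
  refine (norm_sum_le _ _).trans (Finset.sum_le_sum fun i _ => ?_)
  rw [map_smul, mul_smul_comm, norm_smul]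
  exact mul_le_of_le_one_right (norm_nonneg _)
    (hφ.norm_posResolvent_mul_map_unitary_le (Unitary.coe_star_mul_self (u i)) hε)

end Unitary

section Tensor

variable {A C D : Type*} [CStarAlgebra A] [CStarAlgebra C] [CStarAlgebra D] [PartialOrder D]

/-- The linear map `a ⊗ c ↦ ι(a) φ(c)` on the algebraic tensor product. -/
noncomputable def algLift (ι : A →⋆ₐ[ℂ] D) (φ : C →ₗ[ℂ] D) : A ⊗[ℂ] C →ₗ[ℂ] D :=
  TensorProduct.lift ((LinearMap.mul ℂ D).compl₁₂ (ι : A →ₐ[ℂ] D).toLinearMap φ)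

omit [PartialOrder D] in
theorem algLift_tmul (ι : A →⋆ₐ[ℂ] D) (φ : C →ₗ[ℂ] D) (a : A) (c : C) :
    algLift ι φ (a ⊗ₜ[ℂ] c) = ι a * φ c := rfl

variable {ι : A →⋆ₐ[ℂ] D} {φ : C →ₗ[ℂ] D}

omit [PartialOrder D] in
theorem algLift_one : algLift ι φ 1 = φ 1 := by
  rw [Algebra.TensorProduct.one_def, algLift_tmul, map_one, one_mul]

theorem isWeightedHom_algLift (hφ : IsWeightedHom φ) (hcomm : ∀ a c, Commute (ι a) (φ c)) :
    IsWeightedHom (algLift ι φ) where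
  one_nonneg := by rw [algLift_one]; exact hφ.one_nonneg
  map_star x := by
    induction x using TensorProduct.induction_on with
    | zero => simp
    | tmul a c =>
      rw [TensorProduct.star_tmul, algLift_tmul, algLift_tmul, star_mul, hφ.map_star,
        StarHomClass.map_star, ← hφ.map_star, ← StarHomClass.map_star, (hcomm _ _).eq]
    | add x y hx hy => rw [star_add, map_add, map_add, star_add, hx, hy]
  map_mul_map x y := by
    rw [algLift_one]
    induction x using TensorProduct.induction_on with
    | zero => simp
    | add x₁ x₂ h₁ h₂ => simp only [map_add, add_mul, mul_add, h₁, h₂]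
    | tmul a c =>
      induction y using TensorProduct.induction_on with
      | zero => simp
      | add y₁ y₂ h₁ h₂ => simp only [map_add, mul_add, h₁, h₂]
      | tmul b d =>
        rw [Algebra.TensorProduct.tmul_mul_tmul, algLift_tmul, algLift_tmul, algLift_tmul, map_mul,
          ← mul_assoc (φ 1), ← mul_assoc (φ 1), ← (hcomm a 1).eq, (hcomm b c).symm.mul_mul_mul_comm,
          hφ.map_mul_map, mul_assoc (ι a) (φ 1), ← (hcomm b 1).eq]
        simp only [mul_assoc]

variable [StarOrderedRing D]

theorem exists_norm_posResolvent_mul_algLift_le (hφ : IsWeightedHom φ)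
    (hcomm : ∀ a c, Commute (ι a) (φ c)) (x : A ⊗[ℂ] C) :
    ∃ M, ∀ ε, 0 < ε → ‖posResolvent (algLift ι φ 1) ε * algLift ι φ x‖ ≤ M := by
  rw [algLift_one]
  induction x using TensorProduct.induction_on with
  | zero => exact ⟨0, by simp⟩
  | tmul a c =>
    obtain ⟨M, hM⟩ := hφ.exists_norm_posResolvent_mul_map_le c
    refine ⟨‖ι a‖ * M, fun ε hε => ?_⟩
    rw [algLift_tmul, ← mul_assoc, (posResolvent.commute (hcomm a 1).symm).eq, mul_assoc]
    exact (norm_mul_le _ _).trans (mul_le_mul_of_nonneg_left (hM ε hε) (norm_nonneg _))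
  | add x y hx hy =>
    obtain ⟨M, hM⟩ := hx
    obtain ⟨N, hN⟩ := hy
    refine ⟨M + N, fun ε hε => ?_⟩
    rw [map_add, mul_add]
    exact (norm_add_le _ _).trans (add_le_add (hM ε hε) (hN ε hε))

/-- The seminorm built from the resolvents is one of those whose supremum is the maximal norm;
letting `ε → 0` costs only the factor `‖φ 1‖`. -/
theorem norm_algLift_le (hφ : IsWeightedHom φ) (hcomm : ∀ a c, Commute (ι a) (φ c))
    (x : A ⊗[ℂ] C) : ‖algLift ι φ x‖ ≤ ‖φ 1‖ * ‖MaxTensor.ofAlg A C x‖ := by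
  have h := isWeightedHom_algLift hφ hcomm
  obtain ⟨p, hp, hle⟩ := h.exists_isCStarSeminorm
    (exists_norm_posResolvent_mul_algLift_le hφ hcomm)
  rw [← algLift_one (ι := ι), MaxTensor.norm_ofAlg]
  exact h.norm_map_le fun ε hε => (hle x ε hε).trans (hp.le_max x)

/-- For a weighted homomorphism `φ` whose range commutes with that of `ι`, the map
`a ⊗ c ↦ ι(a) φ(c)` extends to a weighted homomorphism on the maximal tensor product. -/
theorem exists_maxTensor_lift (hφ : IsWeightedHom φ) (hcomm : ∀ a c, Commute (ι a) (φ c)) :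
    ∃ ψ : MaxTensor A C →L[ℂ] D, IsWeightedHom (ψ : MaxTensor A C →ₗ[ℂ] D) ∧
      ∀ a c, ψ (MaxTensor.ofAlg A C (a ⊗ₜ[ℂ] c)) = ι a * φ c := by
  let ψ : MaxTensor A C →L[ℂ] D :=
    (algLift ι φ).extendOfNorm (MaxTensor.ofAlg A C).toLinearMap
  have hψ : ∀ x, ψ (MaxTensor.ofAlg A C x) = algLift ι φ x := fun x =>
    LinearMap.extendOfNorm_eq MaxTensor.denseRange_ofAlg ⟨_, norm_algLift_le hφ hcomm⟩ x
  have h := isWeightedHom_algLift hφ hcomm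
  have hone : ψ 1 = algLift ι φ 1 := by
    rw [← hψ, map_one (MaxTensor.ofAlg A C)]
  have hcs : Continuous (star : MaxTensor A C → MaxTensor A C) := MaxTensor.continuous_star
  refine ⟨ψ, ⟨?_, fun x => ?_, fun x y => ?_⟩, fun a c => (hψ _).trans (algLift_tmul _ _ _ _)⟩
  · exact hone ▸ h.one_nonneg
  · change ψ (star x) = star (ψ x)
    refine MaxTensor.denseRange_ofAlg.induction_on x
      (isClosed_eq (ψ.continuous.comp hcs) (ψ.continuous.star)) fun x => ?_
    rw [← MaxTensor.ofAlg_star, hψ, hψ, h.map_star]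
  · change ψ x * ψ y = ψ 1 * ψ (x * y)
    refine MaxTensor.induction₂ (P := fun x y => ψ x * ψ y = ψ 1 * ψ (x * y))
      (isClosed_eq (by fun_prop) (by fun_prop)) (fun x y => ?_) x y
    rw [← map_mul (MaxTensor.ofAlg A C), hψ, hψ, hψ, hone, h.map_mul_map]

omit [StarOrderedRing D] in
/-- If `ψ(ι a) = θ(a) ψ(1)` with `ψ(1)` commuting with `θ(a)`, and `ι a` commutes with `c`, then
`θ(a)` commutes with `ψ c`. -/
theorem commute_of_map_eq_mul {B : Type*} [Ring B] [StarRing B] [Algebra ℂ B] {ψ : B →ₗ[ℂ] D}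
    (hψ : IsWeightedHom ψ) {j : A →⋆ₐ[ℂ] B} (hj : ∀ a, ψ (j a) = ι a * ψ 1)
    (hcomm : ∀ a, Commute (ι a) (ψ 1)) {c : B} (hc : ∀ a, Commute (j a) c) (a : A) :
    Commute (ι a) (ψ c) := by
  set d := ι a * ψ c - ψ c * ι a with hd
  have hgd : ψ 1 * d = 0 := by
    have h1 : ψ (j a) * ψ c = ψ c * ψ (j a) := by
      rw [hψ.map_mul_map, hψ.map_mul_map c, (hc a).eq]
    rw [hj] at h1
    rw [hd, mul_sub, sub_eq_zero, ← mul_assoc, ← mul_assoc, ← (hcomm a).eq, h1,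
      (hcomm a).eq, ← mul_assoc, (hψ.commute_one c).eq]
  -- Every `ψ b` annihilates what `ψ 1` annihilates: `(ψ(b) y)* (ψ(b) y) = y* ψ(b* b) ψ(1) y`.
  have hker : ∀ (b : B) (y : D), ψ 1 * y = 0 → ψ b * y = 0 := fun b y hy => by
    rw [← CStarRing.star_mul_self_eq_zero_iff, star_mul, mul_assoc, ← mul_assoc _ (ψ b),
      hψ.star_map_mul_map, (hψ.commute_one _).eq, mul_assoc _ (ψ 1), hy, mul_zero, mul_zero]
  -- In each term of `d* d` a factor `ψ(c*)` meets `d` or `ι(a*) d`, and `ψ 1` annihilates both.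
  have hdd : star d * d = 0 := by
    have hga : ψ 1 * (ι (star a) * d) = 0 := by
      rw [← mul_assoc, ← (hcomm _).eq, mul_assoc, hgd, mul_zero]
    nth_rw 1 [hd]
    rw [star_sub, star_mul, star_mul, ← hψ.map_star, ← StarHomClass.map_star, sub_mul, mul_assoc,
      mul_assoc, hker _ _ hgd, hker _ _ hga, mul_zero, sub_zero]
  exact sub_eq_zero.1 ((CStarRing.star_mul_self_eq_zero_iff d).1 hdd)

end Tensor

end IsWeightedHom

/-! ### Restriction to a factor and central ultrapower elements -/

/-- The composition of a completely positive map with a `*`-homomorphism. -/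
noncomputable def CompletelyPositiveMap.compStarAlgHom {A B D : Type*} [CStarAlgebra A] [PartialOrder A]
    [StarOrderedRing A] [CStarAlgebra B] [PartialOrder B] [StarOrderedRing B] [CStarAlgebra D]
    [PartialOrder D] [StarOrderedRing D] (ψ : B →CP D) (j : A →⋆ₐ[ℂ] B) : A →CP D where
  __ := ψ.toLinearMap.comp (j : A →ₐ[ℂ] B).toLinearMap
  map_cstarMatrix_nonneg' k M hM :=
    ψ.map_cstarMatrix_nonneg (M.map j)
      (CompletelyPositiveMapClass.map_cstarMatrix_nonneg' j k M hM)

theorem IsOrderZero.compStarAlgHom {A B D : Type*} [CStarAlgebra A] [PartialOrder A]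
    [StarOrderedRing A] [CStarAlgebra B] [PartialOrder B] [StarOrderedRing B] [CStarAlgebra D]
    [PartialOrder D] [StarOrderedRing D] {ψ : B →CP D} (hψ : IsOrderZero ψ) (j : A →⋆ₐ[ℂ] B) :
    IsOrderZero (ψ.compStarAlgHom j) := fun a b ha hb hab hba =>
  hψ (j a) (j b) (map_nonneg j ha) (map_nonneg j hb) (by rw [← map_mul, hab, map_zero])
    (by rw [← map_mul, hba, map_zero])

namespace CStarUltrapower

variable {ω : Ultrafilter ℕ} {A : Type*} [CStarAlgebra A]

theorem mem_central_iff {x : CStarUltrapower ω A} :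
    x ∈ central ω A ↔ ∀ a, Commute (const ω A a) x := by
  rw [central, StarSubalgebra.mem_centralizer_iff]
  constructor
  · rintro h a
    exact (h _ ⟨a, rfl⟩).1
  · rintro h _ ⟨a, rfl⟩
    exact ⟨h a, by rw [← map_star]; exact h _⟩

theorem map_const {B : Type*} [CStarAlgebra B] (α : A →⋆ₐ[ℂ] B) (a : A) :
    map ω α (const ω A a) = const ω B (α a) := rfl

end CStarUltrapower

/-! ### Passing between maps on `C` and maps on `A ⊗_max C` -/

namespace MaxTensor

variable {ω : Ultrafilter ℕ} {A C : Type*} [CStarAlgebra A] [CStarAlgebra C]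

theorem inl_apply (a : A) : inl A C a = ofAlg A C (a ⊗ₜ[ℂ] (1 : C)) := rfl

theorem inr_apply (c : C) : inr A C c = ofAlg A C ((1 : A) ⊗ₜ[ℂ] c) := rfl

theorem commute_inl_inr (a : A) (c : C) : Commute (inl A C a) (inr A C c) := by
  rw [commute_iff_eq, inl_apply, inr_apply, ← _root_.map_mul, ← _root_.map_mul]
  simp

/-- An order zero map on `A ⊗_max C` given by `a ↦ a g` on `A`, with `g` central, maps the second
factor to the central sequence algebra. -/
theorem mem_central_of_isOrderZero {ψ : MaxTensor A C →CP CStarUltrapower ω A}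
    (hψ : IsOrderZero ψ) {g : CStarUltrapower ω A} (hg : g ∈ CStarUltrapower.central ω A)
    (h : ∀ a, ψ (inl A C a) = CStarUltrapower.const ω A a * g) (c : C) :
    ψ (inr A C c) ∈ CStarUltrapower.central ω A := by
  have h1 : ψ 1 = g := by simpa using h 1
  rw [← h1] at hg h
  rw [CStarUltrapower.mem_central_iff] at hg ⊢
  exact hψ.isWeightedHom.commute_of_map_eq_mul h hg fun a => commute_inl_inr a c

variable [PartialOrder C] [StarOrderedRing C]

/-- An order zero map from `C` to the central sequence algebra induces an order zero map on
`A ⊗_max C`. -/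
theorem exists_isOrderZero_lift {φ : C →CP CStarUltrapower ω A} (hφ : IsOrderZero φ)
    (hc : ∀ c, φ c ∈ CStarUltrapower.central ω A) :
    ∃ ψ : MaxTensor A C →CP CStarUltrapower ω A, IsOrderZero ψ ∧ Continuous ψ ∧
      ∀ a c, ψ (ofAlg A C (a ⊗ₜ[ℂ] c)) = CStarUltrapower.const ω A a * φ c := by
  obtain ⟨ψ, hψ, h⟩ := hφ.isWeightedHom.exists_maxTensor_lift
    (ι := CStarUltrapower.const ω A) fun a c => CStarUltrapower.mem_central_iff.1 (hc c) a
  exact ⟨hψ.toCompletelyPositiveMap, hψ.isOrderZero, ψ.continuous, h⟩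

/-- A continuous linear map that is equivariant on elementary tensors is equivariant. -/
theorem map_tensor_aut_eq {G : Type*} [Group G] [TopologicalSpace G]
    {α : CStarAction G A} {β : CStarAction G C} {φ : C →CP CStarUltrapower ω A}
    (hφ : ∀ s c, φ (β.aut s c) = CStarUltrapower.map ω (α.hom s) (φ c))
    {ψ : MaxTensor A C →CP CStarUltrapower ω A} (hcont : Continuous ψ)
    (hψ : ∀ a c, ψ (ofAlg A C (a ⊗ₜ[ℂ] c)) = CStarUltrapower.const ω A a * φ c)
    (s : G) (b : MaxTensor A C) :
    ψ ((α.tensor β).aut s b) = CStarUltrapower.map ω (α.hom s) (ψ b) := by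
  have hα : Continuous (CStarUltrapower.map ω (α.hom s)) :=
    AddMonoidHomClass.continuous_of_bound _ 1 fun x => by
      simpa using NonUnitalStarAlgHom.norm_apply_le (CStarUltrapower.map ω (α.hom s)) x
  have haut : Continuous fun b => (α.tensor β).aut s b :=
    MaxTensor.continuous_map (α.hom s) (β.hom s)
  refine denseRange_ofAlg.induction_on b
    (isClosed_eq (hcont.comp haut) (hα.comp hcont)) fun x => ?_
  induction x using TensorProduct.induction_on with
  | zero => simp
  | tmul a c =>
    change ψ (CStarAction.tensorAut α β s _) = _
    rw [CStarAction.tensorAut_tmul, hψ, hψ, _root_.map_mul, CStarUltrapower.map_const, hφ,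
      CStarAction.hom_apply]
  | add x y hx hy => simp only [map_add, hx, hy]

end MaxTensor

/-! ### The two equivalences -/

theorem propositionP (ω : Ultrafilter ℕ) (hω : (ω : Filter ℕ) ≤ Filter.cofinite)
    {A C : Type*} [CStarAlgebra A] [CStarAlgebra C] [PartialOrder C] [StarOrderedRing C] :
    (IsTraciallySeqSplit ω (MaxTensor.inl A C) ↔
      ∀ z : CStarUltrapower ω A, 0 ≤ z → z ≠ 0 →
        ∃ φ : C →CP CStarUltrapower ω A,
          IsOrderZero φ ∧ (∃ c, φ c ≠ 0) ∧
          (∀ c, φ c ∈ CStarUltrapower.central ω A) ∧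
          CuntzSubeq (1 - φ 1) z) ∧
    (∀ {G : Type*} [Group G] [TopologicalSpace G] [IsTopologicalGroup G] [CompactSpace G]
      (α : CStarAction G A) (β : CStarAction G C),
      IsEquivTraciallySeqSplit ω α (α.tensor β) (MaxTensor.inl A C) ↔
        ∀ x : CStarUltrapower ω A, 0 ≤ x → x ≠ 0 →
          ∃ φ : C →CP CStarUltrapower ω A,
            IsOrderZero φ ∧
            (∀ s c, φ (β.aut s c) = CStarUltrapower.map ω (α.hom s) (φ c)) ∧
            (∀ c, φ c ∈ CStarUltrapower.central ω A) ∧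
            CuntzSubeq (1 - φ 1) x) := by
  have hone : ∀ ψ : MaxTensor A C →CP CStarUltrapower ω A, ∀ g : CStarUltrapower ω A,
      (∀ a, ψ (MaxTensor.inl A C a) = CStarUltrapower.const ω A a * g) →
      ψ (MaxTensor.inr A C 1) = g := fun ψ g h => by
    have := h 1
    rw [map_one (MaxTensor.inl A C), map_one (CStarUltrapower.const ω A), one_mul] at this
    rw [map_one (MaxTensor.inr A C), this]
  refine ⟨⟨fun H z hz hz0 => ?_, fun H z hz hz0 => ?_⟩, fun {G} _ _ _ _ α β =>
    ⟨fun ⟨_, H⟩ z hz hz0 => ?_, fun H => ⟨fun s a => ?_, fun z hz hz0 => ?_⟩⟩⟩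
  · obtain ⟨ψ, g, hψ, hg, -, hg0, h, hsub⟩ := H z hz hz0
    have h1 := hone ψ g h
    exact ⟨ψ.compStarAlgHom (MaxTensor.inr A C), hψ.compStarAlgHom _, ⟨1, h1.trans_ne hg0⟩,
      MaxTensor.mem_central_of_isOrderZero hψ hg h, h1.symm ▸ hsub⟩
  · obtain ⟨φ, hφ, ⟨c, hc⟩, hcen, hsub⟩ := H z hz hz0
    obtain ⟨ψ, hψ, -, h⟩ := MaxTensor.exists_isOrderZero_lift hφ hcen
    -- Nonvanishing passes from `φ` to `g = φ 1` because a weighted homomorphism with zero weight is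
    -- zero.
    exact ⟨ψ, φ 1, hψ, hcen 1, map_nonneg φ zero_le_one,
      fun h0 => hc (hφ.isWeightedHom.map_eq_zero_of_map_one_eq_zero h0 c), fun a => h a 1, hsub⟩
  · obtain ⟨ψ, g, hψ, heq, hg, -, h, hsub⟩ := H z hz hz0
    have h1 := hone ψ g fun a => (h a).2
    refine ⟨ψ.compStarAlgHom (MaxTensor.inr A C), hψ.compStarAlgHom _, fun s c => ?_,
      MaxTensor.mem_central_of_isOrderZero hψ hg fun a => (h a).2, h1.symm ▸ hsub⟩
    -- The second factor embedding is equivariant, since `α_s` fixes 1.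
    refine Eq.trans (congrArg ψ ?_) (heq s (MaxTensor.inr A C c))
    refine Eq.trans ?_ (CStarAction.tensorAut_tmul α β s 1 c).symm
    rw [map_one]
    rfl
  · refine Eq.trans ?_ (CStarAction.tensorAut_tmul α β s a 1).symm
    rw [map_one, MaxTensor.inl_apply]
  · obtain ⟨φ, hφ, heq, hcen, hsub⟩ := H z hz hz0
    obtain ⟨ψ, hψ, hcont, h⟩ := MaxTensor.exists_isOrderZero_lift hφ hcen
    exact ⟨ψ, φ 1, hψ, MaxTensor.map_tensor_aut_eq heq hcont h, hcen 1, map_nonneg φ zero_le_one,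
      fun a => ⟨(h a 1).trans (CStarUltrapower.mem_central_iff.1 (hcen 1) a).eq, h a 1⟩, hsub⟩
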